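/- Let $\mathbb F=\mathbb Z/2\mathbb Z$. Let $G$ be a finite forest with vertex set $V$ and integer framings $m_w$ ($w\in V$), whose incidence matrix $M_G$ (framings on the diagonal, $1$ for each edge) is negative definite; write $x\cdot y$ for the corresponding bilinear form on $\mathbb Z^V$. Let $\mathrm{Char}(G)$ be the set of $K\in\mathrm{Hom}(\mathbb Z^V,\mathbb Z)$ with $K(x)\equiv x\cdot x \pmod 2$, and for $w\in V$ let $w^*$ be the functional $x\mapsto w\cdot x$. For $K\in \mathrm{Char}(G)$ and $I\subset E\subset V$ put $$f([K,I])=\tfrac12\Big(\sum_{w\in I}K(w)+\big(\sum_{w\in I}w\big)^2\Big),\qquad g([K,E])=\min_{I\subset E}f([K,I]),$$ and, for $w\in E$, $a_w[K,E]=g([K,E-w])-g([K,E])$, $b_w[K,E]=\min_{w\in I\subset E}f([K,I])-g([K,E])$. The lattice complex $CF^-(G)$ is the free $\mathbb F[U]$-module on the pairs $[K,E]$, graded by $|E|$, with boundary map $$\partial[K,E]=\sum_{w\in E}\big(U^{a_w[K,E]}[K,E-w]+U^{b_w[K,E]}[K+2w^*,E-w]\big).$$ If an unframed vertex $v_0$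 is joined by edges to some vertices of $G$ (giving $\Gamma_{v_0}$), choose any framing $m_0\in\mathbb Z$ for $v_0$, let $\Sigma=v_0+\sum_{w\in V}a_ww$ ($a_w\in\mathbb Q$) be the unique class with $w\cdot\Sigma=0$ for all $w\in V$, and let $L=L_{[K,E]}$ be the unique characteristic extension of $K$ to the framed graph with $a_{v_0}[L,E\cup v_0]=b_{v_0}[L,E\cup v_0]=0$. The Alexander grading is $A_{v_0}(U^j\otimes[K,E])=\frac12(L(\Sigma)+\Sigma^2)-j$; it does not depend on $m_0$. It filters $CF^-(G)$: level $i\in\mathbb Q$ consists of the elements all of whose components $U^j\otimes [K,E]$ have Alexander grading at most $i$. For a vertex $v$ with $m_v=-k<0$ and $[K,E]$ with $v\notin E$, let $i_0\in\mathbb Z$ be such that $(K+2i_0v^*)(v)\in[-k,k)$, and let $T=-1$ if $a_v[K+2i_0v^*,E\cup v]=0$ and $T=1$ otherwise. Let $H_0$ be the $\mathbb F[U]$-linear map with $H_0[K,E]=[K,E\cup v]$ if $v\notin E$ and $K(v)\ge Tk$, $H_0[K,E]=[K-2v^*,E\cup v]$ if $v\notin E$ and $K(v)<(T-2)k$, and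 $H_0[K,E]=0$ otherwise. Let $C_0=\mathrm{Id}+\partial H_0+H_0\partial$, and let $C_v$ be the stable value of the iterates of $C_0$: $C_v(x)=C_0^n(x)$ for all large $n$ (depending on $x$). Let $v$ be a good vertex of $G$: $m_v+d_v\le 0$, where $d_v$ is the valency of $v$. Let $\Gamma_{v_0}$ be obtained from $G$ by attaching an unframed vertex $v_0$ to $v$ by an edge. Let $\Gamma'_{v_0'}$ be obtained by blowing up the edge $v$–$v_0$ (a new vertex $e$ of framing $-1$ is joined to $v$ and to the unframed vertex, now called $v_0'$; $v$ and $v_0'$ are not joined; the framing of $v$ drops by one), and let $G'=\Gamma'_{v_0'}-v_0'$. Write elements of $\mathrm{Char}(G)$ as $(K,p)$ and of $\mathrm{Char}(G')$ as $(K,p,j)$, with $p,j$ the values on $v,e$ and $K$ the restriction to $G-v$. Let $P:CF^-(G')\to CF^-(G)$ and $R:CF^-(G)\to CF^-(G')$ be the $\mathbb F[U]$-linear maps $$P[(K,p,j),E]=\begin{cases}U^{s}\otimes[(K,p+j),E]& e\notin E\\0&e\in E\end{cases},\qquad s=g[(K,p+j),E]-g[(K,p,j),E]+\tfrac{j^2-1}{8}\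 (\ge 0),$$ $$R[(K,p),E]=C_e[(K,p+1,-1),E].$$ **Theorem.** The maps $C_v$ on $CF^-(G)$ and $C_e$ on $CF^-(G')$ are well defined (the iterates of $C_0$ on each element stabilize); $(CF^-(G),\partial,A_{v_0})$ and $(CF^-(G'),\partial,A_{v_0'})$ are filtered chain complexes ($\partial^2=0$, $\partial$ lowers the grading $|E|$ by one and preserves the filtration levels); and they are filtered chain homotopy equivalent via $R$ and $C_v\circ P$: both are $\mathbb F[U]$-linear chain maps preserving the grading $|E|$ and all filtration levels, and $C_v\circ P\circ R$ and $R\circ C_v\circ P$ are chain homotopic to the identity by $\mathbb F[U]$-linear homotopies of degree $+1$ that preserve all filtration levels. -/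

import Mathlib

open Finset

noncomputable section

namespace LatticeHomology

universe u

/-! ### Plumbing graphs, characteristic classes, weights -/

/-- A plumbing graph: a graph with an integer framing on every vertex. -/
structure PlumbingGraph (V : Type u) where
  graph : SimpleGraph V
  framing : V → ℤ

namespace PlumbingGraph

section

variable {V : Type u} [DecidableEq V] (G : PlumbingGraph V)

open Classical in
/-- The incidence matrix of `G`, with the framings on the diagonal. It is the matrix of the
intersection form of `H₂(X_G; ℤ) = ℤ^V` in the basis given by the vertices. -/
def M : Matrix V V ℤ := fun v w =>
  if v = w then G.framing v else if G.graph.Adj v w then 1 else 0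

/-- The incidence matrix with rational entries: the intersection form on `H₂(X_G; ℚ) = ℚ^V`. -/
def MQ : Matrix V V ℚ := G.M.map (Int.cast : ℤ → ℚ)

theorem M_self (v : V) : G.M v v = G.framing v := by
  simp [M]

theorem M_symm (v w : V) : G.M v w = G.M w v := by
  unfold M
  by_cases h : v = w
  · subst h; rfl
  · rw [if_neg h, if_neg (Ne.symm h), G.graph.adj_comm]

end

variable {V : Type u} [Fintype V] [DecidableEq V] (G : PlumbingGraph V)

/-- The intersection form is negative definite. -/
def NegDef : Prop := ∀ x : V → ℚ, x ≠ 0 → x ⬝ᵥ G.MQ.mulVec x < 0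

open Classical in
/-- A vertex is good if its framing plus its valency is at most zero. -/
def IsGood (v : V) : Prop := G.framing v + (G.graph.degree v : ℤ) ≤ 0

/-- Characteristic elements: `K ∈ Hom(ℤ^V, ℤ)`, recorded by its values on the vertices, with
`K(x) ≡ x · x mod 2` for all `x`. -/
def Char : Type u :=
  {K : V → ℤ // ∀ x : V → ℤ, K ⬝ᵥ x ≡ x ⬝ᵥ G.M.mulVec x [ZMOD 2]}

theorem sum_sum_symm (h : V → V → ZMod 2) (hs : ∀ v w, h v w = h w v) :
    ∑ v, ∑ w, h v w = ∑ v, h v v := by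
  have h1 : ∑ v, ∑ w, h v w = ∑ p : V × V, h p.1 p.2 := by
    rw [Fintype.sum_prod_type]
  have h2 : ∑ p : V × V with ¬ p.1 = p.2, h p.1 p.2 = 0 := by
    refine Finset.sum_involution (fun p _ => (p.2, p.1)) ?_ ?_ ?_ ?_
    · intro p _
      simp only
      rw [hs p.2 p.1]
      exact CharTwo.add_self_eq_zero _
    · intro p hp _ hq
      simp only [mem_filter, mem_univ, true_and] at hp
      exact hp (congrArg Prod.snd hq)
    · intro p hp
      simp only [mem_filter, mem_univ, true_and] at hp ⊢
      exact fun h => hp h.symm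
    · intro p _
      rfl
  have h3 : ∑ p : V × V with p.1 = p.2, h p.1 p.2 = ∑ v, h v v := by
    refine Finset.sum_bij' (fun p _ => p.1) (fun v _ => (v, v)) ?_ ?_ ?_ ?_ ?_
    · simp
    · simp
    · rintro ⟨a, b⟩ hp
      simp only [mem_filter, mem_univ, true_and] at hp
      simp [hp]
    · simp
    · rintro ⟨a, b⟩ hp
      simp only [mem_filter, mem_univ, true_and] at hp
      simp [hp]
  rw [h1, ← Finset.sum_filter_add_sum_filter_not univ (fun p : V × V => p.1 = p.2), h2, h3,
    add_zero]

/-- It is enough to check the parity condition on the vertices. -/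
theorem char_iff (K : V → ℤ) :
    (∀ x : V → ℤ, K ⬝ᵥ x ≡ x ⬝ᵥ G.M.mulVec x [ZMOD 2]) ↔
      ∀ v, K v ≡ G.framing v [ZMOD 2] := by
  constructor
  · intro h v
    simpa [M_self] using h (Pi.single v 1)
  · intro h x
    have h' : ∀ v, (K v : ZMod 2) = (G.framing v : ZMod 2) := fun v =>
      (ZMod.intCast_eq_intCast_iff _ _ 2).2 (h v)
    refine (ZMod.intCast_eq_intCast_iff _ _ 2).1 ?_
    simp only [dotProduct, Matrix.mulVec, Int.cast_sum, Int.cast_mul, Finset.mul_sum]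
    rw [sum_sum_symm (fun v w => (x v : ZMod 2) * ((G.M v w : ZMod 2) * (x w : ZMod 2)))
      (fun v w => by rw [G.M_symm v w]; ring)]
    refine Finset.sum_congr rfl fun v _ => ?_
    rw [M_self, h' v]
    have : ∀ a b : ZMod 2, a * b = b * (a * b) := by decide
    exact this _ _

variable {G}

theorem Char.modEq (K : G.Char) (v : V) : K.1 v ≡ G.framing v [ZMOD 2] :=
  (G.char_iff K.1).1 K.2 v

/-- The characteristic element `K + 2y`, for `y ∈ Hom(ℤ^V, ℤ)`. -/
def Char.shift (K : G.Char) (y : V → ℤ) : G.Char :=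
  ⟨fun w => K.1 w + 2 * y w, (G.char_iff _).2 fun v => by
    have := K.modEq v
    simp only [Int.ModEq] at this ⊢
    omega⟩

variable (G)

/-- The class `v^*`, i.e. the functional `w ↦ v · w`. -/
def dual (v : V) : V → ℤ := fun w => G.M v w

variable {G}

/-- The `G`-weight: `2 f([K,I]) = (∑_{v ∈ I} K(v)) + (∑_{v ∈ I} v)²`; see `two_mul_f`. -/
def f (K : G.Char) (I : Finset V) : ℤ :=
  (∑ v ∈ I, K.1 v + ∑ v ∈ I, ∑ w ∈ I, G.M v w) / 2

theorem two_mul_f (K : G.Char) (I : Finset V) :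
    2 * f K I = ∑ v ∈ I, K.1 v + ∑ v ∈ I, ∑ w ∈ I, G.M v w := by
  have h := K.2 (fun v => if v ∈ I then 1 else 0)
  simp only [dotProduct, Matrix.mulVec, mul_ite, mul_one, mul_zero, ite_mul, one_mul, zero_mul,
    Finset.sum_ite_mem, Finset.univ_inter] at h
  unfold f
  simp only [Int.ModEq] at h
  omega

/-- The minimal `G`-weight: `g([K,E]) = min {f([K,I]) | I ⊆ E}`. -/
def g (K : G.Char) (E : Finset V) : ℤ :=
  E.powerset.inf' ⟨∅, by simp⟩ (f K)

/-- `A_v([K,E]) = g([K,E-v])`. -/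
def A (v : V) (K : G.Char) (E : Finset V) : ℤ := g K (E.erase v)

/-- `B_v([K,E]) = min {f([K,I]) | v ∈ I ⊆ E}` for `v ∈ E`; the sets `I` with `v ∈ I ⊆ E` are
written `J ∪ {v}` with `J ⊆ E - v`. -/
def B (v : V) (K : G.Char) (E : Finset V) : ℤ :=
  (E.erase v).powerset.inf' ⟨∅, by simp⟩ fun J => f K (insert v J)

/-- `a_v[K,E] = A_v([K,E]) - g([K,E])`. -/
def a (v : V) (K : G.Char) (E : Finset V) : ℤ := A v K E - g K E

/-- `b_v[K,E] = B_v([K,E]) - g([K,E])`. -/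
def b (v : V) (K : G.Char) (E : Finset V) : ℤ := B v K E - g K E

theorem a_nonneg (v : V) (K : G.Char) (E : Finset V) : 0 ≤ a v K E :=
  sub_nonneg.2 (Finset.inf'_mono _ (Finset.powerset_mono.2 (Finset.erase_subset v E))
    ⟨∅, by simp⟩)

theorem b_nonneg (v : V) (K : G.Char) (E : Finset V) (hv : v ∈ E) : 0 ≤ b v K E := by
  unfold b B
  refine sub_nonneg.2 (Finset.le_inf' _ _ fun J hJ => Finset.inf'_le _ ?_)
  rw [Finset.mem_powerset] at hJ ⊢
  exact Finset.insert_subset hv (hJ.trans (Finset.erase_subset v E))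

theorem g_eq_min (v : V) (K : G.Char) (E : Finset V) (hv : v ∈ E) :
    g K E = min (A v K E) (B v K E) := by
  refine le_antisymm (le_min (sub_nonneg.1 (a_nonneg v K E)) (sub_nonneg.1 (b_nonneg v K E hv)))
    (Finset.le_inf' _ _ fun I hI => ?_)
  rw [Finset.mem_powerset] at hI
  by_cases h : v ∈ I
  · refine (min_le_right _ _).trans ?_
    have := Finset.inf'_le (s := (E.erase v).powerset) (fun J => f K (insert v J)) (b := I.erase v)
      (Finset.mem_powerset.2 (Finset.erase_subset_erase v hI))
    simp only [Finset.insert_erase h] at this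
    exact this
  · refine (min_le_left _ _).trans ?_
    exact Finset.inf'_le _ (Finset.mem_powerset.2 fun x hx =>
      Finset.mem_erase.2 ⟨by rintro rfl; exact h hx, hI hx⟩)

/-! ### The lattice chain complex `CF⁻(G)` -/

variable (G)

/-- `CF⁻(G)`: the free module over `𝔽[U]`, `𝔽 = ℤ/2ℤ`, on the pairs `[K,E]` with
`K ∈ Char(G)`, `E ⊆ V`. The indeterminate `Polynomial.X` is `U`. -/
abbrev CF : Type u := (G.Char × Finset V) →₀ Polynomial (ZMod 2)

variable {G}

/-- The element `U^n ⊗ [K,E]`. -/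
def gen (n : ℕ) (K : G.Char) (E : Finset V) : G.CF :=
  Finsupp.single (K, E) (Polynomial.X ^ n)

/-- The `𝔽[U]`-linear map out of `CF⁻(G)` with the given values on the generators `[K,E]`. -/
def lift {N : Type*} [AddCommGroup N] [Module (Polynomial (ZMod 2)) N]
    (φ : G.Char → Finset V → N) : G.CF →ₗ[Polynomial (ZMod 2)] N :=
  Finsupp.linearCombination (Polynomial (ZMod 2)) fun x : G.Char × Finset V => φ x.1 x.2

variable (G)

/-- The boundary map. -/
def boundary : G.CF →ₗ[Polynomial (ZMod 2)] G.CF :=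
  lift fun K E => ∑ v ∈ E,
    (gen (a v K E).toNat K (E.erase v) + gen (b v K E).toNat (K.shift (G.dual v)) (E.erase v))

/-- The part of `CF⁻(G)` of `δ`-grading `k`, spanned by the `[K,E]` with `|E| = k`. -/
def deltaPart (k : ℤ) : Submodule (Polynomial (ZMod 2)) G.CF :=
  Finsupp.supported _ _ {x | (x.2.card : ℤ) = k}

/-! ### The contraction map of a vertex -/

variable {G}

/-- The integer `i₀` with `(K + 2 i₀ v^*)(v) ∈ [-k, k)`, where `v² = -k`; see `index_spec`. -/
def index (v : V) (K : G.Char) : ℤ := (K.1 v - G.framing v) / (-2 * G.framing v)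

theorem index_spec (v : V) (hv : G.framing v < 0) (K : G.Char) :
    G.framing v ≤ (K.shift (index v K • G.dual v)).1 v ∧
      (K.shift (index v K • G.dual v)).1 v < -G.framing v := by
  have h1 := Int.emod_add_mul_ediv (K.1 v - G.framing v) (-2 * G.framing v)
  have h2 := Int.emod_nonneg (K.1 v - G.framing v) (b := -2 * G.framing v) (by omega)
  have h3 := Int.emod_lt_of_pos (K.1 v - G.framing v) (b := -2 * G.framing v) (by omega)
  simp only [Char.shift, index, dual, Pi.smul_apply, smul_eq_mul, M_self]
  constructor <;> nlinarith

/-- `T_{[K,E]}`: equal to `-1` if `[K,E]` is of type `a`, i.e. `a_v[K + 2 i₀ v^*, E ∪ v] = 0`,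
and to `1` if it is of type `b`, i.e. `a_v[K + 2 i₀ v^*, E ∪ v] > 0`. -/
def typeSign (v : V) (K : G.Char) (E : Finset V) : ℤ :=
  if a v (K.shift (index v K • G.dual v)) (insert v E) = 0 then -1 else 1

variable (G)

/-- The map `H₀` for the vertex `v` with framing `v² = -k`:
`H₀[K,E] = [K, E ∪ v]` if `v ∉ E` and `K(v) ≥ Tk`, `H₀[K,E] = [K - 2v^*, E ∪ v]` if `v ∉ E` and
`K(v) < (T-2)k`, and `H₀[K,E] = 0` otherwise. -/
def H₀ (v : V) : G.CF →ₗ[Polynomial (ZMod 2)] G.CF :=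
  lift fun K E =>
    if v ∈ E then 0
    else if typeSign v K E * (-G.framing v) ≤ K.1 v then gen 0 K (insert v E)
    else if K.1 v < (typeSign v K E - 2) * (-G.framing v) then
      gen 0 (K.shift (-G.dual v)) (insert v E)
    else 0

/-- `C₀ = Id + ∂ ∘ H₀ + H₀ ∘ ∂`. -/
def C₀ (v : V) : G.CF →ₗ[Polynomial (ZMod 2)] G.CF :=
  LinearMap.id + G.boundary ∘ₗ G.H₀ v + G.H₀ v ∘ₗ G.boundary

open Classical in
/-- The contraction map `C_v = C₀^∞`: its value on `[K,E]` is the stable value of the iterates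
`C₀^N [K,E]`. -/
def contraction (v : V) : G.CF →ₗ[Polynomial (ZMod 2)] G.CF :=
  lift fun K E =>
    if h : ∃ N : ℕ, (G.C₀ v ^ (N + 1)) (gen 0 K E) = (G.C₀ v ^ N) (gen 0 K E) then
      (G.C₀ v ^ h.choose) (gen 0 K E)
    else 0

/-! ### Blowing up a vertex; the maps `P` and `R` -/

/-- Blowing up the vertex `v`: the new vertex `e`, written `none`, has framing `-1` and is joined
to `v` only; the framing of `v` drops by one. -/
def blowUp (v : V) : PlumbingGraph (Option V) where
  graph :=
    { Adj := fun x y => match x, y with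
        | some x, some y => G.graph.Adj x y
        | none, some y => y = v
        | some x, none => x = v
        | none, none => False
      symm := ⟨by
        rintro (_ | x) (_ | y) h
        · exact h
        · exact h
        · exact h
        · exact G.graph.adj_symm h⟩
      loopless := ⟨by
        rintro (_ | x) h
        · exact h
        · exact G.graph.loopless.irrefl x h⟩ }
  framing := fun x => match x with
    | none => -1
    | some x => G.framing x - if x = v then 1 else 0

variable {G} {v : V}

/-- `(K, p, j) ↦ (K, p + j)`. -/
def Char.down (K : (G.blowUp v).Char) : G.Char :=
  ⟨fun w => K.1 (some w) + if w = v then K.1 none else 0, (G.char_iff _).2 fun w => by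
    have h1 := K.modEq (some w)
    have h2 := K.modEq none
    simp only [blowUp, Int.ModEq] at h1 h2 ⊢
    split_ifs at h1 ⊢ <;> omega⟩

/-- `(K, p) ↦ (K, p + 1, -1)`. -/
def Char.up (v : V) (K : G.Char) : (G.blowUp v).Char :=
  ⟨fun x => match x with
    | none => -1
    | some w => K.1 w + if w = v then 1 else 0, ((G.blowUp v).char_iff _).2 fun x => by
    match x with
    | none => rfl
    | some w =>
      have h1 := K.modEq w
      simp only [blowUp, Int.ModEq] at h1 ⊢
      split_ifs <;> omega⟩

/-- The exponent `s = g[(K,p+j),E] - g[(K,p,j),E] + (j² - 1)/8`, for `e ∉ E`. -/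
def blowDownExponent (K : (G.blowUp v).Char) (E : Finset V) : ℤ :=
  g K.down E - g K (E.map Function.Embedding.some) + (K.1 none ^ 2 - 1) / 8

theorem eight_dvd (K : (G.blowUp v).Char) : (8 : ℤ) ∣ K.1 none ^ 2 - 1 := by
  have h : K.1 none % 2 = 1 := K.modEq none
  exact Int.eight_dvd_sq_sub_one_of_odd (Int.odd_iff.2 h)

theorem two_mul_f_down (K : (G.blowUp v).Char) (I : Finset V) :
    2 * f K.down I =
      2 * f K (I.map Function.Embedding.some) + if v ∈ I then K.1 none + 1 else 0 := by
  have hM : ∀ w u, (G.blowUp v).M (some w) (some u) =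
      G.M w u - if w = u then (if w = v then 1 else 0) else 0 := by
    intro w u
    unfold M
    by_cases h : w = u
    · subst h; simp [blowUp]
    · simp [blowUp, h]; congr
  rw [two_mul_f, two_mul_f]
  simp only [Finset.sum_map, Function.Embedding.some_apply, hM, Finset.sum_sub_distrib, Char.down,
    Finset.sum_add_distrib, Finset.sum_ite_eq, Finset.sum_ite_eq']
  have h : ∑ x ∈ I, (if x ∈ I then (if x = v then (1 : ℤ) else 0) else 0) =
      if v ∈ I then 1 else 0 := by
    rw [Finset.sum_congr rfl fun x hx => if_pos hx, Finset.sum_ite_eq']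
  rw [h]
  split_ifs <;> ring

theorem blowDownExponent_nonneg (K : (G.blowUp v).Char) (E : Finset V) :
    0 ≤ blowDownExponent K E := by
  obtain ⟨I, hI, hg⟩ := Finset.exists_mem_eq_inf' (s := E.powerset) ⟨∅, by simp⟩ (f K.down)
  have h1 : g K.down E = f K.down I := hg
  have h2 : g K (E.map Function.Embedding.some) ≤ f K (I.map Function.Embedding.some) :=
    Finset.inf'_le _ (by simpa using hI)
  have h3 := two_mul_f_down K I
  obtain ⟨c, hc⟩ := eight_dvd K
  have h4 : K.1 none % 2 = 1 := K.modEq none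
  have h5 : 0 ≤ c := by
    have := sq_pos_of_ne_zero (a := K.1 none) (by omega)
    omega
  have h6 : 0 ≤ (K.1 none + 1) * (K.1 none + 3) := by
    rcases le_or_gt (K.1 none) (-3) with h | h
    · exact mul_nonneg_of_nonpos_of_nonpos (by omega) (by omega)
    · exact mul_nonneg (by omega) (by omega)
  unfold blowDownExponent
  rw [hc, Int.mul_ediv_cancel_left _ (by norm_num)]
  split_ifs at h3
  · nlinarith
  · linarith

variable (G)

/-- The blow-down map: `P[(K,p,j),E] = U^s ⊗ [(K,p+j),E]` if `e ∉ E`, and `0` if `e ∈ E`. -/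
def blowDownMap (v : V) : (G.blowUp v).CF →ₗ[Polynomial (ZMod 2)] G.CF :=
  lift fun K E =>
    if none ∈ E then 0
    else gen (blowDownExponent K (Finset.eraseNone E)).toNat K.down (Finset.eraseNone E)

/-- The blow-up map: `R[(K,p),E] = C_e[(K,p+1,-1),E]`. -/
def blowUpMap (v : V) : G.CF →ₗ[Polynomial (ZMod 2)] (G.blowUp v).CF :=
  lift fun K E =>
    (G.blowUp v).contraction none (gen 0 (K.up v) (E.map Function.Embedding.some))

end PlumbingGraph

/-! ### Graphs with an unframed vertex and the Alexander filtration -/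

/-- A graph `Γ_{v₀}` with a distinguished unframed vertex `v₀`, given by the plumbing graph
`G = Γ_{v₀} - v₀` and the set of those vertices of `G` that are joined to `v₀` by an edge. -/
structure UnframedGraph (V : Type u) where
  background : PlumbingGraph V
  nbrs : Finset V

theorem inf'_powerset_map {V : Type u} (E : Finset V) (F : Finset (Option V) → ℤ) :
    (E.map Function.Embedding.some).powerset.inf' ⟨∅, by simp⟩ F =
      E.powerset.inf' ⟨∅, by simp⟩ fun I => F (I.map Function.Embedding.some) := by
  apply le_antisymm
  · refine Finset.le_inf' _ _ fun I hI => Finset.inf'_le _ ?_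
    simpa using hI
  · refine Finset.le_inf' _ _ fun J hJ => ?_
    obtain ⟨I, hI, rfl⟩ := Finset.subset_map_iff.1 (Finset.mem_powerset.1 hJ)
    exact Finset.inf'_le (fun I : Finset V => F (I.map Function.Embedding.some))
      (Finset.mem_powerset.2 hI)

namespace UnframedGraph

open PlumbingGraph

variable {V : Type u} [Fintype V] [DecidableEq V] (Γ : UnframedGraph V)

/-- The framed graph `G_{m₀}(v₀)` obtained by giving `v₀`, written `none`, the framing `m₀`. -/
def withFraming (m₀ : ℤ) : PlumbingGraph (Option V) where
  graph :=
    { Adj := fun x y => match x, y with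
        | some x, some y => Γ.background.graph.Adj x y
        | none, some y => y ∈ Γ.nbrs
        | some x, none => x ∈ Γ.nbrs
        | none, none => False
      symm := ⟨by
        rintro (_ | x) (_ | y) h
        · exact h
        · exact h
        · exact h
        · exact Γ.background.graph.adj_symm h⟩
      loopless := ⟨by
        rintro (_ | x) h
        · exact h
        · exact Γ.background.graph.loopless.irrefl x h⟩ }
  framing := fun x => match x with
    | none => m₀
    | some x => Γ.background.framing x

/-- The restriction of `v₀^*` to `G`. -/
def dual₀ : V → ℤ := fun w => if w ∈ Γ.nbrs then 1 else 0

/-- The class `Σ = v₀ + ∑ a_j v_j` with `v_j · Σ = 0` for all `j > 0`; see `Sigma_spec`. -/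
def Sig : Option V → ℚ := fun x => match x with
  | none => 1
  | some w => -(Γ.background.MQ⁻¹.mulVec (fun y => (Γ.dual₀ y : ℚ))) w

/-- The extension `L_{[K,E]}` of `K` to a characteristic element of `G_{m₀}(v₀)`, characterized
by `a_{v₀}[L, E ∪ v₀] = b_{v₀}[L, E ∪ v₀] = 0`; see `ext_spec`. -/
def ext (m₀ : ℤ) (K : Γ.background.Char) (E : Finset V) : (Γ.withFraming m₀).Char :=
  ⟨fun x => match x with
    | none => -m₀ + 2 * g K E - 2 * g (K.shift Γ.dual₀) E
    | some w => K.1 w, ((Γ.withFraming m₀).char_iff _).2 fun x => by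
    match x with
    | none =>
      simp only [withFraming, Int.ModEq]
      omega
    | some w => exact K.modEq w⟩

theorem Sigma_spec (hneg : Γ.background.NegDef) (m₀ : ℤ) (S : Option V → ℚ) :
    (S none = 1 ∧ ∀ w, (Γ.withFraming m₀).MQ.mulVec S (some w) = 0) ↔ S = Γ.Sig := by
  have hinj : Function.Injective Γ.background.MQ.mulVec := by
    intro x y hxy
    by_contra hne
    have h0 := hneg (x - y) (sub_ne_zero.2 hne)
    rw [Matrix.mulVec_sub] at h0
    rw [hxy, sub_self, dotProduct_zero] at h0
    exact lt_irrefl _ h0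
  have hu : IsUnit Γ.background.MQ.det :=
    (Matrix.isUnit_iff_isUnit_det _).1 (Matrix.mulVec_injective_iff_isUnit.1 hinj)
  have hrow : ∀ S : Option V → ℚ, ∀ w, (Γ.withFraming m₀).MQ.mulVec S (some w) =
      (Γ.dual₀ w : ℚ) * S none + Γ.background.MQ.mulVec (fun y => S (some y)) w := by
    intro S w
    simp only [Matrix.mulVec, dotProduct, Fintype.sum_option]
    congr 1
    · simp [MQ, M, withFraming, dual₀]
    · refine Finset.sum_congr rfl fun y _ => ?_
      simp [MQ, M, withFraming]
  have hS : ∀ w, Γ.background.MQ.mulVec (fun y => Γ.Sig (some y)) w = -(Γ.dual₀ w : ℚ) := by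
    intro w
    have h1 : (fun y => Γ.Sig (some y)) =
        -(Γ.background.MQ⁻¹.mulVec (fun y => (Γ.dual₀ y : ℚ))) := rfl
    rw [h1, Matrix.mulVec_neg, Matrix.mulVec_mulVec, Matrix.mul_nonsing_inv _ hu,
      Matrix.one_mulVec]
    rfl
  constructor
  · rintro ⟨h1, h2⟩
    have h3 : (fun y => S (some y)) = fun y => Γ.Sig (some y) := by
      apply hinj
      funext w
      have h4 := h2 w
      rw [hrow, h1] at h4
      rw [hS]
      linarith
    funext x
    match x with
    | none => exact h1
    | some w => exact congrFun h3 w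
  · rintro rfl
    refine ⟨rfl, fun w => ?_⟩
    rw [hrow, hS]
    simp [Sig]

theorem ext_spec (m₀ : ℤ) (K : Γ.background.Char) (E : Finset V) (L : (Γ.withFraming m₀).Char) :
    ((∀ w, L.1 (some w) = K.1 w) ∧ a none L (Finset.insertNone E) = 0 ∧
      b none L (Finset.insertNone E) = 0) ↔ L = Γ.ext m₀ K E := by
  have herase : (Finset.insertNone E).erase none = E.map Function.Embedding.some := by
    ext x
    cases x <;> simp
  have key : (∀ w, L.1 (some w) = K.1 w) →
      A none L (Finset.insertNone E) = g K E ∧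
      2 * B none L (Finset.insertNone E) = L.1 none + m₀ + 2 * g (K.shift Γ.dual₀) E := by
    intro hL
    have hM : ∀ w u, (Γ.withFraming m₀).M (some w) (some u) = Γ.background.M w u := by
      intro w u
      simp [M, withFraming]; congr
    have hM0 : ∀ w, (Γ.withFraming m₀).M (some w) none = Γ.dual₀ w := by
      intro w
      simp [M, withFraming, dual₀]; congr
    have hM0' : ∀ w, (Γ.withFraming m₀).M none (some w) = Γ.dual₀ w := by
      intro w
      simp [M, withFraming, dual₀]; congr
    have hM00 : (Γ.withFraming m₀).M none none = m₀ := by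
      simp [M, withFraming]
    have hf : ∀ I : Finset V, f L (I.map Function.Embedding.some) = f K I := by
      intro I
      have h1 := two_mul_f L (I.map Function.Embedding.some)
      have h2 := two_mul_f K I
      simp only [Finset.sum_map, Function.Embedding.some_apply, hM, hL] at h1
      omega
    obtain ⟨c, hc⟩ : ∃ c, L.1 none + m₀ = 2 * c := by
      have := L.modEq none
      simp only [withFraming, Int.ModEq] at this
      exact ⟨(L.1 none + m₀) / 2, by omega⟩
    have hf' : ∀ I : Finset V, f L (insert none (I.map Function.Embedding.some)) =
        c + f (K.shift Γ.dual₀) I := by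
      intro I
      have h1 := two_mul_f L (insert none (I.map Function.Embedding.some))
      have h2 := two_mul_f (K.shift Γ.dual₀) I
      have hn : (none : Option V) ∉ I.map Function.Embedding.some := by simp
      simp only [Finset.sum_insert hn, Finset.sum_map, Function.Embedding.some_apply, hM, hL, hM0,
        hM0', hM00, Finset.sum_add_distrib] at h1
      have h3 : ∑ w ∈ I, (K.shift Γ.dual₀).1 w = ∑ w ∈ I, K.1 w + 2 * ∑ w ∈ I, Γ.dual₀ w := by
        simp only [Char.shift, Finset.sum_add_distrib, ← Finset.mul_sum]
      omega
    constructor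
    · unfold A g
      rw [herase, inf'_powerset_map]
      exact Finset.inf'_congr _ rfl fun I _ => hf I
    · have : B none L (Finset.insertNone E) = c + g (K.shift Γ.dual₀) E := by
        unfold B g
        simp only [herase]
        rw [inf'_powerset_map E fun J => f L (insert none J)]
        apply le_antisymm
        · obtain ⟨I, hI, hg⟩ := Finset.exists_mem_eq_inf' (s := E.powerset) ⟨∅, by simp⟩
            (f (K.shift Γ.dual₀))
          rw [hg, ← hf' I]
          exact Finset.inf'_le (fun I : Finset V => f L (insert none (I.map _))) hI
        · refine Finset.le_inf' _ _ fun I hI => ?_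
          rw [hf' I]
          have := Finset.inf'_le (f (K.shift Γ.dual₀)) hI
          linarith
      rw [this, hc]
      ring
  have hmin := g_eq_min none L (Finset.insertNone E) (by simp)
  constructor
  · rintro ⟨hL, ha, hb⟩
    obtain ⟨k1, k2⟩ := key hL
    apply Subtype.ext
    funext x
    match x with
    | none =>
      unfold a at ha
      unfold b at hb
      simp only [ext]
      omega
    | some w => exact hL w
  · intro h
    have hL : ∀ w, L.1 (some w) = K.1 w := by
      intro w
      rw [h]
      rfl
    have h0 : L.1 none = -m₀ + 2 * g K E - 2 * g (K.shift Γ.dual₀) E := by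
      rw [h]
      rfl
    obtain ⟨k1, k2⟩ := key hL
    refine ⟨hL, ?_, ?_⟩
    · unfold a
      omega
    · unfold b
      omega

/-- The Alexander grading `A([K,E]) = (L(Σ) + Σ²)/2`, computed with the framing `m₀` on `v₀`. -/
def alexander (m₀ : ℤ) (K : Γ.background.Char) (E : Finset V) : ℚ :=
  (∑ x, ((Γ.ext m₀ K E).1 x : ℚ) * Γ.Sig x +
    Γ.Sig ⬝ᵥ (Γ.withFraming m₀).MQ.mulVec Γ.Sig) / 2

/-- The Alexander filtration on `CF⁻(G)`: the level `i` consists of the `x` all of whose components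
`U^n ⊗ [K,E]` have Alexander grading `A([K,E]) - n ≤ i`. -/
def alexanderFiltration (m₀ : ℤ) (i : ℚ) : Submodule (ZMod 2) Γ.background.CF where
  carrier := {x | ∀ K E n, (x (K, E)).coeff n ≠ 0 → Γ.alexander m₀ K E - n ≤ i}
  zero_mem' := by
    intro K E n h
    simp at h
  add_mem' := by
    intro x y hx hy K E n h
    by_cases h1 : (x (K, E)).coeff n = 0
    · refine hy K E n fun h2 => h ?_
      simp [h1, h2]
    · exact hx K E n h1
  smul_mem' := by
    intro c x hx K E n h
    refine hx K E n fun h2 => h ?_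
    simp [h2]

/-- Blowing up the edge joining `v₀` to the vertex `v`: the new vertex `e`, written `none`, has
framing `-1` and is joined to `v` and to `v₀`, which are no longer joined to each other; the
framing of `v` drops by one. -/
abbrev blowUpEdge (v : V) : UnframedGraph (Option V) where
  background := Γ.background.blowUp v
  nbrs := insert none ((Γ.nbrs.erase v).map Function.Embedding.some)

end UnframedGraph

/-- The graph obtained from `G` by attaching an unframed vertex `v₀` to the vertex `v`. -/
abbrev PlumbingGraph.attach {V : Type u} (G : PlumbingGraph V) (v : V) : UnframedGraph V where
  background := G
  nbrs := {v}

/-- Blowing up the edge joining `v` to `v₀` is the same as blowing up `v` in `G` and attaching an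
unframed vertex to the new vertex `e`. -/
theorem PlumbingGraph.blowUpEdge_attach {V : Type u} [DecidableEq V] (G : PlumbingGraph V)
    (v : V) : (G.attach v).blowUpEdge v = (G.blowUp v).attach none := by
  simp [UnframedGraph.blowUpEdge, PlumbingGraph.attach]

/-! ### Filtered chain complexes over `𝔽[U]` and their homotopy equivalences -/

section Filtered

variable {M N : Type u} [AddCommGroup M] [Module (Polynomial (ZMod 2)) M] [Module (ZMod 2) M]
  [AddCommGroup N] [Module (Polynomial (ZMod 2)) N] [Module (ZMod 2) N]

/-- `φ` maps the `k`-th graded part into the `(k + c)`-th one, for every `k`. -/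
def HasDegree (c : ℤ) (D : ℤ → Submodule (Polynomial (ZMod 2)) M)
    (D' : ℤ → Submodule (Polynomial (ZMod 2)) N) (φ : M →ₗ[Polynomial (ZMod 2)] N) : Prop :=
  ∀ k, ∀ x ∈ D k, φ x ∈ D' (k + c)

/-- `φ` maps the `i`-th filtration level into the `i`-th filtration level, for every `i`. -/
def IsFiltered (F : ℚ → Submodule (ZMod 2) M) (F' : ℚ → Submodule (ZMod 2) N)
    (φ : M →ₗ[Polynomial (ZMod 2)] N) : Prop :=
  ∀ i, ∀ x ∈ F i, φ x ∈ F' i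

/-- A filtered chain complex: `d` has square zero, lowers the grading by one and respects the
increasing filtration. -/
structure IsFilteredComplex (d : M →ₗ[Polynomial (ZMod 2)] M)
    (D : ℤ → Submodule (Polynomial (ZMod 2)) M) (F : ℚ → Submodule (ZMod 2) M) : Prop where
  sq_zero : d ∘ₗ d = 0
  degree : HasDegree (-1) D D d
  mono : Monotone F
  filtered : IsFiltered F F d

/-- A filtered chain map: it commutes with the boundary maps, preserves the grading and respects
the filtrations. -/
structure IsFilteredChainMap (d : M →ₗ[Polynomial (ZMod 2)] M)
    (D : ℤ → Submodule (Polynomial (ZMod 2)) M) (F : ℚ → Submodule (ZMod 2) M)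
    (d' : N →ₗ[Polynomial (ZMod 2)] N)
    (D' : ℤ → Submodule (Polynomial (ZMod 2)) N) (F' : ℚ → Submodule (ZMod 2) N)
    (φ : M →ₗ[Polynomial (ZMod 2)] N) : Prop where
  comm : φ ∘ₗ d = d' ∘ₗ φ
  degree : HasDegree 0 D D' φ
  filtered : IsFiltered F F' φ

/-- `φ` and `ψ` are filtered chain homotopic endomorphisms. -/
def IsFilteredHomotopic (d : M →ₗ[Polynomial (ZMod 2)] M)
    (D : ℤ → Submodule (Polynomial (ZMod 2)) M) (F : ℚ → Submodule (ZMod 2) M)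
    (φ ψ : M →ₗ[Polynomial (ZMod 2)] M) : Prop :=
  ∃ h : M →ₗ[Polynomial (ZMod 2)] M,
    HasDegree 1 D D h ∧ IsFiltered F F h ∧ φ - ψ = d ∘ₗ h + h ∘ₗ d

/-- `φ` and `ψ` are mutually inverse filtered chain homotopy equivalences. -/
structure IsFilteredHomotopyEquiv (d : M →ₗ[Polynomial (ZMod 2)] M)
    (D : ℤ → Submodule (Polynomial (ZMod 2)) M) (F : ℚ → Submodule (ZMod 2) M)
    (d' : N →ₗ[Polynomial (ZMod 2)] N)
    (D' : ℤ → Submodule (Polynomial (ZMod 2)) N) (F' : ℚ → Submodule (ZMod 2) N)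
    (φ : M →ₗ[Polynomial (ZMod 2)] N) (ψ : N →ₗ[Polynomial (ZMod 2)] M) : Prop where
  map : IsFilteredChainMap d D F d' D' F' φ
  inv : IsFilteredChainMap d' D' F' d D F ψ
  homotopy_id : IsFilteredHomotopic d D F (ψ ∘ₗ φ) LinearMap.id
  homotopy_id' : IsFilteredHomotopic d' D' F' (φ ∘ₗ ψ) LinearMap.id

end Filtered

end LatticeHomology

end

noncomputable section

namespace LatticeHomology

universe u

/-! ### The weight of a cube -/

namespace PlumbingGraph

/-! Put w[K,E] = K²/8 + g[K,E] (`weight`), the minimum of K²/8 over the corners of the cube. The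
exponents a_v and b_v are the increments of w on passing to the two v-faces, so in the rescaled
generators U^(q+w)[K,E] (`hgen`) the differential is the plain cubical boundary mod 2
(`boundary_hgen`). The Alexander grading becomes w[K,E] − w[K+2v₀^*,E] (`alexander_eq`), from which
m₀ has disappeared.

Contraction: fix E not containing v. Goodness makes w unimodal along the column K + 2iv^*: it rises
weakly, then falls strictly (`a_eq_zero_iff`, `a_eq_zero_of_shift`). H₀ pairs every member of the
column except one at the peak with an adjacent cube containing v, and C₀ moves everything one step
towards the peak. Hence the iterates stabilize, C_v kills cubes containing v, and C_v = 1 + ∂η + η∂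
with η = ∑ C₀^m H₀. Adding 2v₀^* tilts w along the column by one unit per step; as the increments of
w are integers, H₀ preserves the Alexander grading of the generators it does not kill.

Blow-up: replacing v by v + e splits off a summand ⟨−1⟩, so K² = K.down² − j² (`quad_down`). In
rescaled generators P just forgets e, and R is C_e applied to a lift. Since C_e is constant on
e-columns (`contraction_hgen`) and lifting K.down gives a member of the e-column of K, one gets PR =
1 and RP = C_e, and R is a chain map. So C_v P R = C_v ≃ 1 and R C_v P ≃ RP = C_e ≃ 1. The delicate
filtration estimate is the one for R (`weight_up_shift_dual₀`). -/

theorem MQ_transpose {V : Type u} [DecidableEq V] (G : PlumbingGraph V) :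
    G.MQ.transpose = G.MQ := by
  ext v w
  simp [MQ, G.M_symm v w]

variable {V : Type u} [Fintype V] [DecidableEq V] {G : PlumbingGraph V}

theorem Char.ext_iff' {K L : G.Char} : K = L ↔ ∀ w, K.1 w = L.1 w :=
  ⟨fun h w => by rw [h], fun h => Subtype.ext (funext h)⟩

theorem Char.shift_apply (K : G.Char) (y : V → ℤ) (w : V) : (K.shift y).1 w = K.1 w + 2 * y w :=
  rfl

theorem Char.shift_shift (K : G.Char) (y z : V → ℤ) : (K.shift y).shift z = K.shift (y + z) :=
  Char.ext_iff'.2 fun w => by simp only [Char.shift_apply, Pi.add_apply]; ring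

theorem Char.shift_comm (K : G.Char) (y z : V → ℤ) :
    (K.shift y).shift z = (K.shift z).shift y := by
  rw [Char.shift_shift, Char.shift_shift, add_comm]

theorem Char.shift_zero (K : G.Char) : K.shift 0 = K :=
  Char.ext_iff'.2 fun w => by simp [Char.shift_apply]

theorem Char.shift_neg_shift (K : G.Char) (y : V → ℤ) : (K.shift (-y)).shift y = K := by
  rw [Char.shift_shift, neg_add_cancel, Char.shift_zero]

theorem two_mul_f_singleton (K : G.Char) (v : V) : 2 * f K {v} = K.1 v + G.framing v := by
  rw [two_mul_f]; simp [M_self]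

theorem two_mul_f_insert (K : G.Char) {v : V} {J : Finset V} (hv : v ∉ J) :
    2 * f K (insert v J) = 2 * f K J + K.1 v + G.framing v + 2 * ∑ w ∈ J, G.M v w := by
  rw [two_mul_f, two_mul_f]
  simp only [Finset.sum_insert hv, Finset.sum_add_distrib, M_self]
  rw [Finset.sum_congr rfl fun w _ => G.M_symm w v]
  ring

/-- The edges between `v` and `J` contribute to `f` exactly what adding 2v^* to `K` contributes on
`J`. This turns `B` into a value of `g` at the opposite face. -/
theorem f_insert (K : G.Char) {v : V} {J : Finset V} (hv : v ∉ J) :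
    f K (insert v J) = f K {v} + f (K.shift (G.dual v)) J := by
  have h1 := two_mul_f_insert K hv
  have h2 := two_mul_f_singleton K v
  have h3 := two_mul_f K J
  have h4 := two_mul_f (K.shift (G.dual v)) J
  simp only [Char.shift_apply, Finset.sum_add_distrib, ← Finset.mul_sum, dual] at h4
  omega

theorem B_eq (v : V) (K : G.Char) (E : Finset V) :
    B v K E = f K {v} + g (K.shift (G.dual v)) (E.erase v) := by
  have h : ∀ J ∈ (E.erase v).powerset,
      f K (insert v J) = f K {v} + f (K.shift (G.dual v)) J := fun J hJ =>
    f_insert K fun hv => Finset.notMem_erase v E (Finset.mem_powerset.1 hJ hv)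
  unfold B g
  refine le_antisymm ?_ (Finset.le_inf' _ _ fun J hJ => ?_)
  · obtain ⟨J, hJ, hg⟩ := Finset.exists_mem_eq_inf' (s := (E.erase v).powerset) ⟨∅, by simp⟩
      (f (K.shift (G.dual v)))
    rw [hg, ← h J hJ]
    exact Finset.inf'_le _ hJ
  · rw [h J hJ]
    have := Finset.inf'_le (f (K.shift (G.dual v))) hJ
    linarith

theorem g_congr {V' : Type*} [Fintype V'] [DecidableEq V'] {G' : PlumbingGraph V'}
    (K : G.Char) (L : G'.Char) (E : Finset V) (i : V ↪ V')
    (h : ∀ I ⊆ E, f L (I.map i) = f K I) : g L (E.map i) = g K E := by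
  unfold g
  refine le_antisymm (Finset.le_inf' _ _ fun I hI => ?_) (Finset.le_inf' _ _ fun J hJ => ?_)
  · rw [← h I (Finset.mem_powerset.1 hI)]
    exact Finset.inf'_le _ (Finset.mem_powerset.2 (Finset.map_subset_map.2
      (Finset.mem_powerset.1 hI)))
  · obtain ⟨I, hI, rfl⟩ := Finset.subset_map_iff.1 (Finset.mem_powerset.1 hJ)
    rw [h I hI]
    exact Finset.inf'_le _ (Finset.mem_powerset.2 hI)

theorem NegDef.isUnit_det (hneg : G.NegDef) : IsUnit G.MQ.det := by
  refine (Matrix.isUnit_iff_isUnit_det _).1 (Matrix.mulVec_injective_iff_isUnit.1 fun x y hxy => ?_)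
  by_contra hne
  have h0 := hneg (x - y) (sub_ne_zero.2 hne)
  rw [Matrix.mulVec_sub, hxy, sub_self, dotProduct_zero] at h0
  exact lt_irrefl _ h0

theorem NegDef.framing_neg (hneg : G.NegDef) (v : V) : G.framing v < 0 := by
  have := hneg (Pi.single v 1) (by simp)
  simpa [MQ, M_self] using this

/-- The rational vector of values of `K` on the vertices. -/
def Char.toRat (K : G.Char) : V → ℚ := fun w => K.1 w

theorem Char.toRat_shift (K : G.Char) (y : V → ℤ) :
    (K.shift y).toRat = K.toRat + (2 : ℚ) • fun w => (y w : ℚ) := by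
  funext w
  simp [Char.toRat, Char.shift_apply]

/-- One eighth of the square of `K` with respect to the intersection form. -/
def quad (K : G.Char) : ℚ := K.toRat ⬝ᵥ G.MQ⁻¹.mulVec K.toRat / 8

/-- The weight of the cube `[K,E]`: the minimum of `quad` over its corners. -/
def weight (K : G.Char) (E : Finset V) : ℚ := quad K + g K E

theorem inv_symm (x y : V → ℚ) : x ⬝ᵥ G.MQ⁻¹.mulVec y = y ⬝ᵥ G.MQ⁻¹.mulVec x := by
  rw [dotProduct_comm, Matrix.dotProduct_mulVec, ← Matrix.mulVec_transpose,
    Matrix.transpose_nonsing_inv, MQ_transpose]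

theorem quad_shift (K : G.Char) (y : V → ℤ) :
    quad (K.shift y) = quad K + (K.toRat ⬝ᵥ G.MQ⁻¹.mulVec (fun w => (y w : ℚ)) +
      (fun w => (y w : ℚ)) ⬝ᵥ G.MQ⁻¹.mulVec (fun w => (y w : ℚ))) / 2 := by
  unfold quad
  rw [Char.toRat_shift]
  simp only [Matrix.mulVec_add, Matrix.mulVec_smul, add_dotProduct, dotProduct_add, smul_dotProduct,
    dotProduct_smul, smul_eq_mul]
  rw [inv_symm (fun w => (y w : ℚ)) K.toRat]
  ring

theorem quad_eq (hneg : G.NegDef) (K : G.Char) (x : V → ℚ) (hx : G.MQ.mulVec x = K.toRat) :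
    quad K = x ⬝ᵥ G.MQ.mulVec x / 8 := by
  unfold quad
  rw [← hx, Matrix.mulVec_mulVec, Matrix.nonsing_inv_mul _ hneg.isUnit_det, Matrix.one_mulVec,
    dotProduct_comm]

/-- The inverse matrix sends v^* to the basis vector of `v`, so only the values at `v` survive in
`quad_shift`. -/
theorem quad_shift_dual (hneg : G.NegDef) (K : G.Char) (v : V) :
    quad (K.shift (G.dual v)) = quad K + f K {v} := by
  have h1 : (fun w => (G.dual v w : ℚ)) = G.MQ.mulVec (Pi.single v 1) := by
    funext w
    simp [MQ, dual, G.M_symm v w]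
  have h2 : G.MQ⁻¹.mulVec (fun w => (G.dual v w : ℚ)) = Pi.single v 1 := by
    rw [h1, Matrix.mulVec_mulVec, Matrix.nonsing_inv_mul _ hneg.isUnit_det, Matrix.one_mulVec]
  have h3 : (2 * f K {v} : ℚ) = K.1 v + G.framing v := by
    exact_mod_cast two_mul_f_singleton K v
  rw [quad_shift, h2]
  simp only [dotProduct_single, mul_one, Char.toRat, dual, M_self]
  linarith

theorem weight_front (v : V) (K : G.Char) (E : Finset V) :
    weight K (E.erase v) = weight K E + a v K E := by
  simp [weight, a, A]

theorem weight_back (hneg : G.NegDef) (v : V) (K : G.Char) (E : Finset V) :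
    weight (K.shift (G.dual v)) (E.erase v) = weight K E + b v K E := by
  simp only [weight, b, B_eq, quad_shift_dual hneg]
  push_cast
  ring

theorem min_a_b (v : V) (K : G.Char) (E : Finset V) (hv : v ∈ E) :
    min (a v K E) (b v K E) = 0 := by
  have := g_eq_min v K E hv
  unfold a b
  omega

theorem weight_eq_min (hneg : G.NegDef) {v : V} (K : G.Char) {E : Finset V} (hv : v ∈ E) :
    weight K E = min (weight K (E.erase v)) (weight (K.shift (G.dual v)) (E.erase v)) := by
  rw [weight_front, weight_back hneg, min_add_add_left]
  have : (min (a v K E : ℚ) (b v K E : ℚ)) = 0 := by exact_mod_cast min_a_b v K E hv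
  rw [this, add_zero]

end PlumbingGraph

/-! ### The Alexander grading in terms of weights. -/

namespace UnframedGraph

open PlumbingGraph

variable {V : Type u} [Fintype V] [DecidableEq V] (Γ : UnframedGraph V)

/-- Σ = v₀ − M⁻¹v₀^*, so Σ² contributes m₀ and the value L(v₀) contributes −m₀. What is left is the
change of `quad` and of `g` under K ↦ K + 2v₀^*. -/
theorem alexander_eq (hneg : Γ.background.NegDef) (m₀ : ℤ) (K : Γ.background.Char)
    (E : Finset V) :
    Γ.alexander m₀ K E = weight K E - weight (K.shift Γ.dual₀) E := by
  have h1 : Γ.Sig ⬝ᵥ (Γ.withFraming m₀).MQ.mulVec Γ.Sig =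
      m₀ - (fun w => (Γ.dual₀ w : ℚ)) ⬝ᵥ Γ.background.MQ⁻¹.mulVec (fun w => (Γ.dual₀ w : ℚ)) := by
    have h2 := ((Γ.Sigma_spec hneg m₀ Γ.Sig).2 rfl).2
    simp only [dotProduct, Fintype.sum_option, h2, mul_zero, Finset.sum_const_zero, add_zero]
    simp only [Matrix.mulVec, dotProduct, Fintype.sum_option]
    simp [Sig, MQ, M, withFraming, dual₀, Matrix.mulVec, dotProduct, sub_eq_add_neg]
  have h3 : ∑ x, ((Γ.ext m₀ K E).1 x : ℚ) * Γ.Sig x =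
      -m₀ + 2 * g K E - 2 * g (K.shift Γ.dual₀) E -
        K.toRat ⬝ᵥ Γ.background.MQ⁻¹.mulVec (fun w => (Γ.dual₀ w : ℚ)) := by
    simp [Fintype.sum_option, ext, Sig, dotProduct, Char.toRat, sub_eq_add_neg]
  unfold alexander weight
  rw [h1, h3, quad_shift]
  ring

end UnframedGraph

/-! ### Maps out of the lattice complex -/

namespace PlumbingGraph

open Polynomial

section Generators

variable {V : Type u} [Fintype V] [DecidableEq V] {G : PlumbingGraph V}

theorem add_self_eq_zero_of_poly {M : Type*} [AddCommGroup M] [Module (ZMod 2)[X] M] (x : M) :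
    x + x = 0 := by
  have h : (2 : (ZMod 2)[X]) = 0 := CharTwo.two_eq_zero
  rw [← two_smul (ZMod 2)[X] x, h, zero_smul]

theorem sub_eq_add_of_poly {M : Type*} [AddCommGroup M] [Module (ZMod 2)[X] M] (x y : M) :
    x - y = x + y := by
  rw [sub_eq_iff_eq_add, add_assoc, add_self_eq_zero_of_poly, add_zero]

theorem lift_gen {N : Type*} [AddCommGroup N] [Module (ZMod 2)[X] N]
    (φ : G.Char → Finset V → N) (n : ℕ) (K : G.Char) (E : Finset V) :
    lift φ (gen n K E) = (X ^ n : (ZMod 2)[X]) • φ K E := by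
  simp [lift, gen]

theorem lift_gen_zero {N : Type*} [AddCommGroup N] [Module (ZMod 2)[X] N]
    (φ : G.Char → Finset V → N) (K : G.Char) (E : Finset V) :
    lift φ (gen 0 K E) = φ K E := by
  simp [lift_gen]

theorem X_pow_smul_gen (m n : ℕ) (K : G.Char) (E : Finset V) :
    (X ^ m : (ZMod 2)[X]) • gen n K E = gen (m + n) K E := by
  simp [gen, pow_add]

theorem gen_eq_smul (n : ℕ) (K : G.Char) (E : Finset V) :
    gen n K E = (X ^ n : (ZMod 2)[X]) • gen 0 K E := by
  rw [X_pow_smul_gen, add_zero]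

theorem single_eq_smul (p : (ZMod 2)[X]) (K : G.Char) (E : Finset V) :
    (Finsupp.single (K, E) p : G.CF) = p • gen 0 K E := by
  simp [gen]

theorem hom_ext {N : Type*} [AddCommGroup N] [Module (ZMod 2)[X] N]
    {φ ψ : G.CF →ₗ[(ZMod 2)[X]] N} (h : ∀ K E, φ (gen 0 K E) = ψ (gen 0 K E)) : φ = ψ := by
  refine Finsupp.lhom_ext fun c p => ?_
  rw [single_eq_smul, map_smul, map_smul, h]

theorem mem_of_gen_mem {N : Type*} [AddCommGroup N] [Module (ZMod 2)[X] N]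
    (φ : G.CF →ₗ[(ZMod 2)[X]] N) (S : Submodule (ZMod 2)[X] N) {x : G.CF}
    (h : ∀ c ∈ x.support, φ (gen 0 c.1 c.2) ∈ S) : φ x ∈ S := by
  rw [← Finsupp.sum_single x, Finsupp.sum, map_sum]
  refine Submodule.sum_mem _ fun c hc => ?_
  rw [show (Finsupp.single c (x c) : G.CF) = x c • gen 0 c.1 c.2 from single_eq_smul _ _ _,
    map_smul]
  exact S.smul_mem _ (h c hc)

theorem smul_X_pow_injective (n : ℕ) {x y : G.CF}
    (h : (X ^ n : (ZMod 2)[X]) • x = (X ^ n : (ZMod 2)[X]) • y) : x = y := by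
  ext1 c
  have h1 := DFunLike.congr_fun h c
  simp only [Finsupp.smul_apply, smul_eq_mul] at h1
  exact mul_left_cancel₀ (pow_ne_zero n X_ne_zero) h1

/-- The element `U^n ⊗ [K,E]` with `n = q + weight K E`. -/
def hgen (q : ℚ) (K : G.Char) (E : Finset V) : G.CF := gen ⌊q + weight K E⌋.toNat K E

/-- `q + weight K E` is the exponent of a monomial. -/
def Adm (q : ℚ) (K : G.Char) (E : Finset V) : Prop := ∃ n : ℕ, q + weight K E = n

theorem hgen_eq_gen {q : ℚ} {K : G.Char} {E : Finset V} {n : ℕ} (h : q + weight K E = n) :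
    hgen q K E = gen n K E := by
  rw [hgen, h, Int.floor_natCast, Int.toNat_natCast]

/-- With q = −w every generator is a rescaled one, so linear maps are determined by the admissible
`hgen`. Without `Adm` the floor and truncation in `hgen` carry no meaning. -/
theorem exists_hgen_eq (K : G.Char) (E : Finset V) :
    ∃ q : ℚ, Adm q K E ∧ hgen q K E = gen 0 K E := by
  have h : -weight K E + weight K E = ((0 : ℕ) : ℚ) := by simp
  exact ⟨-weight K E, ⟨0, h⟩, hgen_eq_gen h⟩

theorem Adm.front {q : ℚ} {K : G.Char} {E : Finset V} (h : Adm q K E) (v : V) :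
    Adm q K (E.erase v) := by
  obtain ⟨n, hn⟩ := h
  obtain ⟨m, hm⟩ := Int.eq_ofNat_of_zero_le (a_nonneg v K E)
  refine ⟨n + m, ?_⟩
  rw [weight_front, hm]
  push_cast
  linarith

theorem Adm.back (hneg : G.NegDef) {q : ℚ} {K : G.Char} {E : Finset V} (h : Adm q K E) {v : V}
    (hv : v ∈ E) : Adm q (K.shift (G.dual v)) (E.erase v) := by
  obtain ⟨n, hn⟩ := h
  obtain ⟨m, hm⟩ := Int.eq_ofNat_of_zero_le (b_nonneg v K E hv)
  refine ⟨n + m, ?_⟩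
  rw [weight_back hneg, hm]
  push_cast
  linarith

theorem smul_gen_front {q : ℚ} {K : G.Char} {E : Finset V} {n : ℕ} (h : q + weight K E = n)
    (v : V) : (X ^ n : (ZMod 2)[X]) • gen (a v K E).toNat K (E.erase v) =
      hgen q K (E.erase v) := by
  obtain ⟨m, hm⟩ := Int.eq_ofNat_of_zero_le (a_nonneg v K E)
  rw [hm, X_pow_smul_gen, Int.toNat_natCast, hgen_eq_gen (n := n + m)]
  rw [weight_front, hm]
  push_cast
  linarith

theorem smul_gen_back (hneg : G.NegDef) {q : ℚ} {K : G.Char} {E : Finset V} {n : ℕ}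
    (h : q + weight K E = n) {v : V} (hv : v ∈ E) :
    (X ^ n : (ZMod 2)[X]) • gen (b v K E).toNat (K.shift (G.dual v)) (E.erase v) =
      hgen q (K.shift (G.dual v)) (E.erase v) := by
  obtain ⟨m, hm⟩ := Int.eq_ofNat_of_zero_le (b_nonneg v K E hv)
  rw [hm, X_pow_smul_gen, Int.toNat_natCast, hgen_eq_gen (n := n + m)]
  rw [weight_back hneg, hm]
  push_cast
  linarith

theorem boundary_gen_zero (K : G.Char) (E : Finset V) :
    G.boundary (gen 0 K E) = ∑ v ∈ E, (gen (a v K E).toNat K (E.erase v) +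
      gen (b v K E).toNat (K.shift (G.dual v)) (E.erase v)) :=
  lift_gen_zero _ _ _

/-- All powers of U are absorbed: a cube and its faces carry the same `q`. -/
theorem boundary_hgen (hneg : G.NegDef) {q : ℚ} {K : G.Char} {E : Finset V} (h : Adm q K E) :
    G.boundary (hgen q K E) =
      ∑ v ∈ E, (hgen q K (E.erase v) + hgen q (K.shift (G.dual v)) (E.erase v)) := by
  obtain ⟨n, hn⟩ := h
  rw [hgen_eq_gen hn, boundary, lift_gen, Finset.smul_sum]
  refine Finset.sum_congr rfl fun v hv => ?_
  rw [smul_add, smul_gen_front hn, smul_gen_back hneg hn hv]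

theorem hom_ext_hgen {N : Type*} [AddCommGroup N] [Module (ZMod 2)[X] N]
    {φ ψ : G.CF →ₗ[(ZMod 2)[X]] N}
    (h : ∀ q K E, Adm q K E → φ (hgen q K E) = ψ (hgen q K E)) : φ = ψ := by
  refine hom_ext fun K E => ?_
  obtain ⟨q, hq, hq'⟩ := exists_hgen_eq K E
  rw [← hq', h q K E hq]

theorem boundary_sq (hneg : G.NegDef) : G.boundary ∘ₗ G.boundary = 0 := by
  refine hom_ext_hgen fun q K E hq => ?_
  simp only [LinearMap.comp_apply, LinearMap.zero_apply]
  rw [boundary_hgen hneg hq, map_sum]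
  have h1 : ∀ v ∈ E, G.boundary (hgen q K (E.erase v) + hgen q (K.shift (G.dual v)) (E.erase v)) =
      ∑ w ∈ E.erase v, ((hgen q K ((E.erase v).erase w) +
        hgen q (K.shift (G.dual w)) ((E.erase v).erase w)) +
        (hgen q (K.shift (G.dual v)) ((E.erase v).erase w) +
        hgen q ((K.shift (G.dual v)).shift (G.dual w)) ((E.erase v).erase w))) := fun v hv => by
    rw [map_add, boundary_hgen hneg (hq.front v), boundary_hgen hneg (hq.back hneg hv),
      ← Finset.sum_add_distrib]
  rw [Finset.sum_congr rfl h1, Finset.sum_sigma']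
  -- Removing v then w, or w then v, yields the same four faces, which cancel in characteristic 2.
  refine Finset.sum_involution (fun p _ => ⟨p.2, p.1⟩) ?_ ?_ ?_ ?_
  · rintro ⟨v, w⟩ _
    simp only
    rw [Finset.erase_right_comm (a := w), Char.shift_comm K (G.dual w)]
    rw [add_add_add_comm (hgen q K _) (hgen q (K.shift (G.dual v)) _)]
    exact add_self_eq_zero_of_poly _
  · rintro ⟨v, w⟩ hp _ h
    simp only [Finset.mem_sigma, Finset.mem_erase] at hp
    exact hp.2.1 (congrArg Sigma.fst h)
  · rintro ⟨v, w⟩ hp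
    simp only [Finset.mem_sigma, Finset.mem_erase] at hp ⊢
    exact ⟨hp.2.2, Ne.symm hp.2.1, hp.1⟩
  · rintro ⟨v, w⟩ _
    rfl

theorem gen_mem_deltaPart (n : ℕ) (K : G.Char) (E : Finset V) :
    gen n K E ∈ G.deltaPart E.card :=
  Finsupp.single_mem_supported _ _ rfl

theorem hasDegree_of_gen {V' : Type u} [Fintype V'] [DecidableEq V'] {G' : PlumbingGraph V'}
    {φ : G.CF →ₗ[(ZMod 2)[X]] G'.CF} {c : ℤ}
    (h : ∀ K E, φ (gen 0 K E) ∈ G'.deltaPart (E.card + c)) :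
    HasDegree c G.deltaPart G'.deltaPart φ := by
  intro k x hx
  refine mem_of_gen_mem φ _ fun p hp => ?_
  have := (Finsupp.mem_supported _ _).1 hx hp
  rw [← show (p.2.card : ℤ) = k from this]
  exact h _ _

theorem boundary_hasDegree : HasDegree (-1) G.deltaPart G.deltaPart G.boundary := by
  refine hasDegree_of_gen fun K E => ?_
  rw [boundary_gen_zero]
  refine Submodule.sum_mem _ fun v hv => ?_
  have h : (E.card : ℤ) + -1 = ((E.erase v).card : ℤ) := by
    rw [Finset.card_erase_of_mem hv]
    have := Finset.card_pos.2 ⟨v, hv⟩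
    omega
  rw [h]
  exact Submodule.add_mem _ (gen_mem_deltaPart _ _ _) (gen_mem_deltaPart _ _ _)

end Generators

end PlumbingGraph

/-! ### Filtration levels and the boundary map. -/

namespace UnframedGraph

open PlumbingGraph Polynomial

variable {V : Type u} [Fintype V] [DecidableEq V] (Γ : UnframedGraph V) (m₀ : ℤ)

theorem gen_mem_alexanderFiltration {n : ℕ} {K : Γ.background.Char} {E : Finset V} {i : ℚ}
    (h : Γ.alexander m₀ K E - n ≤ i) : gen n K E ∈ Γ.alexanderFiltration m₀ i := by
  classical
  intro K' E' n' h'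
  rw [gen, Finsupp.single_apply] at h'
  split_ifs at h' with hc
  · rw [Polynomial.coeff_X_pow] at h'
    split_ifs at h' with hn
    · obtain ⟨rfl, rfl⟩ := Prod.mk.inj hc
      rw [hn]
      exact h
    · exact absurd rfl h'
  · simp at h'

theorem X_pow_smul_mem {n : ℕ} {x : Γ.background.CF} {i j : ℚ}
    (hx : x ∈ Γ.alexanderFiltration m₀ i) (hij : i - n ≤ j) :
    (X ^ n : (ZMod 2)[X]) • x ∈ Γ.alexanderFiltration m₀ j := by
  intro K E k hk
  rw [Finsupp.smul_apply, smul_eq_mul, mul_comm, Polynomial.coeff_mul_X_pow'] at hk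
  split_ifs at hk with h
  · have := hx K E (k - n) hk
    rw [Nat.cast_sub h] at this
    linarith
  · exact absurd rfl hk

theorem alexanderFiltration_mono : Monotone (Γ.alexanderFiltration m₀) :=
  fun _ _ hij _ hx K E n h => (hx K E n h).trans hij

theorem isFiltered_of_gen {V' : Type u} [Fintype V'] [DecidableEq V'] {Γ' : UnframedGraph V'}
    {m₀' : ℤ} {φ : Γ.background.CF →ₗ[(ZMod 2)[X]] Γ'.background.CF}
    (h : ∀ K E, φ (gen 0 K E) ∈ Γ'.alexanderFiltration m₀' (Γ.alexander m₀ K E)) :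
    IsFiltered (Γ.alexanderFiltration m₀) (Γ'.alexanderFiltration m₀') φ := by
  intro i x hx
  rw [← Finsupp.sum_single x, Finsupp.sum, map_sum]
  refine Submodule.sum_mem _ fun c _ => ?_
  rw [show (Finsupp.single c (x c) : Γ.background.CF) = x c • gen 0 c.1 c.2 from
    single_eq_smul _ _ _, map_smul, (x c).as_sum_support, Finset.sum_smul]
  refine Submodule.sum_mem _ fun n hn => ?_
  -- The only nonzero element of ℤ/2 is 1, so each polynomial is a sum of powers of U.
  have h1 : (x c).coeff n = 1 := by
    have h2 := Polynomial.mem_support_iff.1 hn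
    revert h2
    generalize (x c).coeff n = y
    revert y
    decide
  rw [h1, Polynomial.monomial_one_right_eq_X_pow]
  exact Γ'.X_pow_smul_mem m₀' (h c.1 c.2) (hx c.1 c.2 n (by rw [h1]; exact one_ne_zero))

/-- For each face the drop in Alexander grading, including the power of U, is the exponent a_v or
b_v of the cube at K + 2v₀^*, which is nonnegative. -/
theorem boundary_isFiltered (hneg : Γ.background.NegDef) :
    IsFiltered (Γ.alexanderFiltration m₀) (Γ.alexanderFiltration m₀) Γ.background.boundary := by
  refine Γ.isFiltered_of_gen m₀ fun K E => ?_
  rw [boundary_gen_zero]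
  refine Submodule.sum_mem _ fun v hv => Submodule.add_mem _ ?_ ?_
  · refine Γ.gen_mem_alexanderFiltration m₀ ?_
    obtain ⟨m, hm⟩ := Int.eq_ofNat_of_zero_le (a_nonneg v K E)
    have h1 := weight_front v K E
    have h2 := weight_front v (K.shift Γ.dual₀) E
    have h3 : (0 : ℚ) ≤ a v (K.shift Γ.dual₀) E := by exact_mod_cast a_nonneg v _ E
    rw [hm] at h1 ⊢
    rw [Γ.alexander_eq hneg, Γ.alexander_eq hneg, h1, h2]
    push_cast
    simp only [Int.toNat_natCast]
    linarith
  · refine Γ.gen_mem_alexanderFiltration m₀ ?_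
    obtain ⟨m, hm⟩ := Int.eq_ofNat_of_zero_le (b_nonneg v K E hv)
    have h1 := weight_back hneg v K E
    have h2 := weight_back hneg v (K.shift Γ.dual₀) E
    have h3 : (0 : ℚ) ≤ b v (K.shift Γ.dual₀) E := by exact_mod_cast b_nonneg v _ E hv
    rw [hm] at h1 ⊢
    rw [Γ.alexander_eq hneg, Γ.alexander_eq hneg, Char.shift_comm K, h1, h2]
    push_cast
    simp only [Int.toNat_natCast]
    linarith

theorem isFilteredComplex (hneg : Γ.background.NegDef) :
    IsFilteredComplex Γ.background.boundary Γ.background.deltaPart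
      (Γ.alexanderFiltration m₀) where
  sq_zero := boundary_sq hneg
  degree := boundary_hasDegree
  mono := Γ.alexanderFiltration_mono m₀
  filtered := Γ.boundary_isFiltered m₀ hneg

end UnframedGraph

/-! ### Eventually constant sequences of linear maps -/

section Eventual

open Filter

variable {R M N : Type*} [CommRing R] [AddCommGroup M] [Module R M] [AddCommGroup N] [Module R N]

theorem exists_eventual_limit (f : ℕ → M →ₗ[R] N)
    (h : ∀ x, ∃ y, ∀ᶠ n in atTop, f n x = y) :
    ∃ F : M →ₗ[R] N, ∀ x, ∀ᶠ n in atTop, f n x = F x := by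
  choose F hF using h
  refine ⟨⟨⟨F, fun x y => ?_⟩, fun c x => ?_⟩, hF⟩
  · obtain ⟨n, ⟨h1, h2⟩, h3⟩ := (((hF x).and (hF y)).and (hF (x + y))).exists
    rw [← h1, ← h2, ← h3, map_add]
  · obtain ⟨n, h1, h2⟩ := ((hF x).and (hF (c • x))).exists
    simp only [RingHom.id_apply]
    rw [← h1, ← h2, map_smul]

/-- The vectors that are killed by a power of `T`. -/
def locallyNilpotentPart (T : M →ₗ[R] M) : Submodule R M where
  carrier := {x | ∀ᶠ n in atTop, (T ^ n) x = 0}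
  zero_mem' := by simp
  add_mem' := by
    intro x y hx hy
    filter_upwards [hx, hy] with n h1 h2
    rw [map_add, h1, h2, add_zero]
  smul_mem' := by
    intro c x hx
    filter_upwards [hx] with n h1
    rw [map_smul, h1, smul_zero]

theorem mem_locallyNilpotentPart_of_pow {T : M →ₗ[R] M} {x : M} {n : ℕ} (h : (T ^ n) x = 0) :
    x ∈ locallyNilpotentPart T := by
  filter_upwards [eventually_ge_atTop n] with m hm
  rw [← Nat.sub_add_cancel hm, pow_add, Module.End.mul_apply, h, map_zero]

theorem mem_locallyNilpotentPart_of_apply {T : M →ₗ[R] M} {x : M}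
    (h : T x ∈ locallyNilpotentPart T) : x ∈ locallyNilpotentPart T := by
  obtain ⟨n, hn⟩ := Filter.Eventually.exists (f := atTop) h
  refine mem_locallyNilpotentPart_of_pow (n := n + 1) ?_
  rw [pow_succ, Module.End.mul_apply, hn]

/-- The vectors on which the iterates of `T` stabilize. -/
def stablePart (T : M →ₗ[R] M) : Submodule R M := (locallyNilpotentPart T).comap (T - 1)

theorem mem_stablePart {T : M →ₗ[R] M} {x : M} :
    x ∈ stablePart T ↔ T x - x ∈ locallyNilpotentPart T := Iff.rfl

theorem mem_stablePart_of_apply {T : M →ₗ[R] M} {x : M} (h : T x ∈ stablePart T) :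
    x ∈ stablePart T := by
  rw [mem_stablePart, ← map_sub] at h
  exact mem_locallyNilpotentPart_of_apply h

theorem locallyNilpotentPart_le_stablePart (T : M →ₗ[R] M) :
    locallyNilpotentPart T ≤ stablePart T := by
  intro x hx
  rw [mem_stablePart]
  refine Submodule.sub_mem _ ?_ hx
  obtain ⟨n, hn⟩ := Filter.Eventually.exists (f := atTop) hx
  refine mem_locallyNilpotentPart_of_pow (n := n) ?_
  rw [← Module.End.mul_apply, ← pow_succ, pow_succ', Module.End.mul_apply, hn, map_zero]

theorem pow_eq_of_pow_succ_eq {T : M →ₗ[R] M} {x : M} {n : ℕ}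
    (h : (T ^ (n + 1)) x = (T ^ n) x) {m : ℕ} (hm : n ≤ m) : (T ^ m) x = (T ^ n) x := by
  induction m, hm using Nat.le_induction with
  | base => rfl
  | succ m _ ih => rw [pow_succ', Module.End.mul_apply, ih, ← Module.End.mul_apply, ← pow_succ', h]

theorem exists_pow_succ_eq_of_mem_stablePart {T : M →ₗ[R] M} {x : M} (h : x ∈ stablePart T) :
    ∃ n : ℕ, (T ^ (n + 1)) x = (T ^ n) x := by
  obtain ⟨n, hn⟩ := Filter.Eventually.exists (f := atTop) (mem_stablePart.1 h)
  refine ⟨n, ?_⟩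
  rw [map_sub, sub_eq_zero] at hn
  rw [pow_succ, Module.End.mul_apply, hn]

end Eventual

namespace PlumbingGraph

open Polynomial

/-! ### Columns in the direction of a good vertex -/

section Columns

theorem M_nonneg_of_ne {V : Type u} [DecidableEq V] (G : PlumbingGraph V) {v w : V} (h : v ≠ w) :
    0 ≤ G.M v w := by
  simp only [M, if_neg h]
  split_ifs <;> norm_num

theorem dual_self {V : Type u} [DecidableEq V] (G : PlumbingGraph V) (v : V) :
    G.dual v v = G.framing v :=
  M_self G v

variable {V : Type u} [Fintype V] [DecidableEq V] {G : PlumbingGraph V} {v : V}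

/-- The total number of edges from `v` to other vertices is at most `-v²`, and `v² < 0`. -/
structure IsContractible (G : PlumbingGraph V) (v : V) : Prop where
  neg : G.framing v < 0
  sum_le : ∀ J : Finset V, v ∉ J → ∑ w ∈ J, G.M v w ≤ -G.framing v

theorem IsGood.isContractible (hneg : G.NegDef) (h : G.IsGood v) : G.IsContractible v where
  neg := hneg.framing_neg v
  sum_le := by
    classical
    intro J hv
    unfold IsGood at h
    have h1 : ∑ w ∈ J, G.M v w = ((J.filter (G.graph.Adj v)).card : ℤ) := by
      rw [Finset.card_filter, Nat.cast_sum]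
      refine Finset.sum_congr rfl fun w hw => ?_
      have : v ≠ w := fun hvw => hv (hvw ▸ hw)
      simp only [M, if_neg this]
      push_cast
      rfl
    have h2 : (J.filter (G.graph.Adj v)).card ≤ G.graph.degree v := by
      rw [← SimpleGraph.card_neighborFinset_eq_degree]
      refine Finset.card_le_card fun w hw => ?_
      rw [SimpleGraph.mem_neighborFinset]
      exact (Finset.mem_filter.1 hw).2
    have h3 : (G.graph.degree v : ℤ) ≤ -G.framing v := by
      convert (by linarith : (G.graph.degree v : ℤ) ≤ -G.framing v)
    rw [h1]
    exact le_trans (by exact_mod_cast h2) h3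

/-- Delete `v` from a set realizing `B`; the edges from `v` count nonnegatively. Together with the
next bound, this decides the sign of b_v − a_v outside the window [m_v, −m_v). -/
theorem le_two_mul_b_sub_a (K : G.Char) {E : Finset V} (hv : v ∉ E) :
    K.1 v + G.framing v ≤ 2 * (b v K (insert v E) - a v K (insert v E)) := by
  have h0 : (insert v E).erase v = E := Finset.erase_insert hv
  obtain ⟨J, hJ, hB⟩ := Finset.exists_mem_eq_inf' (s := E.powerset) ⟨∅, by simp⟩
    (fun J => f K (insert v J))
  have hB' : B v K (insert v E) = f K (insert v J) := by simp only [B, h0]; exact hB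
  have hA : A v K (insert v E) ≤ f K J := by
    simp only [A, h0]; exact Finset.inf'_le _ hJ
  have hvJ : v ∉ J := fun h => hv (Finset.mem_powerset.1 hJ h)
  have h1 := two_mul_f_insert K hvJ
  have h2 : 0 ≤ ∑ w ∈ J, G.M v w :=
    Finset.sum_nonneg fun w hw => G.M_nonneg_of_ne fun h => hvJ (h ▸ hw)
  unfold a b
  linarith

/-- Goodness enters here: at most −m_v edges run from `v` into a set realizing `A`. -/
theorem IsContractible.two_mul_b_sub_a_le (h : G.IsContractible v) (K : G.Char) {E : Finset V}
    (hv : v ∉ E) :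
    2 * (b v K (insert v E) - a v K (insert v E)) ≤ K.1 v - G.framing v := by
  have h0 : (insert v E).erase v = E := Finset.erase_insert hv
  obtain ⟨J, hJ, hA⟩ := Finset.exists_mem_eq_inf' (s := E.powerset) ⟨∅, by simp⟩ (f K)
  have hA' : A v K (insert v E) = f K J := by simp only [A, h0]; exact hA
  have hB : B v K (insert v E) ≤ f K (insert v J) := by
    simp only [B, h0]; exact Finset.inf'_le (fun J => f K (insert v J)) hJ
  have hvJ : v ∉ J := fun h => hv (Finset.mem_powerset.1 hJ h)
  have h1 := two_mul_f_insert K hvJ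
  have h2 := h.sum_le J hvJ
  unfold a b
  linarith

/-- The representative inside the window depends only on the column. -/
theorem typeSign_shift (hneg : G.framing v < 0) (K : G.Char) (E : Finset V) :
    typeSign v (K.shift (G.dual v)) E = typeSign v K E := by
  have h1 : index v (K.shift (G.dual v)) = index v K + -1 := by
    unfold index
    rw [Char.shift_apply, dual_self, ← Int.add_mul_ediv_right _ _ (by omega)]
    congr 1
    ring
  have h2 : (K.shift (G.dual v)).shift (index v (K.shift (G.dual v)) • G.dual v) =
      K.shift (index v K • G.dual v) := by
    rw [Char.shift_shift, h1, add_smul]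
    congr 1
    simp
  unfold typeSign
  rw [h2]

theorem typeSign_eq (K : G.Char) (E : Finset V) :
    typeSign v K E = -1 ∨ typeSign v K E = 1 := by
  unfold typeSign
  split_ifs <;> simp

/-- Outside the window the two bounds and min(a_v, b_v) = 0 decide whether a_v vanishes. Inside it
`K` is its own representative, and T is defined by a_v. Thus the numerical conditions in H₀ are
conditions on a_v. -/
theorem IsContractible.a_eq_zero_iff (h : G.IsContractible v) (K : G.Char) {E : Finset V}
    (hv : v ∉ E) :
    a v K (insert v E) = 0 ↔ typeSign v K E * (-G.framing v) ≤ K.1 v := by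
  have h1 := le_two_mul_b_sub_a K hv
  have h2 := h.two_mul_b_sub_a_le K hv
  have h3 := min_a_b v K (insert v E) (Finset.mem_insert_self v E)
  have h4 := typeSign_eq (v := v) K E
  have hn := h.neg
  rcases lt_or_ge (K.1 v) (G.framing v) with hlo | hlo
  · refine ⟨fun _ => by omega, fun h5 => ?_⟩
    rcases h4 with h4 | h4 <;> rw [h4] at h5 <;> omega
  · rcases le_or_gt (-G.framing v) (K.1 v) with hhi | hhi
    · refine ⟨fun _ => ?_, fun _ => by omega⟩
      rcases h4 with h4 | h4 <;> rw [h4] <;> omega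
    · have h5 : index v K = 0 := by
        unfold index
        exact Int.ediv_eq_zero_of_lt (by omega) (by omega)
      have h6 : typeSign v K E = if a v K (insert v E) = 0 then -1 else 1 := by
        unfold typeSign
        rw [h5, zero_smul, Char.shift_zero]
      rw [h6]
      split_ifs with h7
      · simp [h7]; omega
      · simp [h7]; omega

/-- This is unimodality: once the weight falls strictly along the column, it keeps falling. -/
theorem IsContractible.a_eq_zero_of_shift (h : G.IsContractible v) {K : G.Char} {E : Finset V}
    (hv : v ∉ E) (ha : a v (K.shift (G.dual v)) (insert v E) = 0) :
    a v K (insert v E) = 0 := by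
  rw [h.a_eq_zero_iff _ hv, typeSign_shift h.neg, Char.shift_apply, dual_self] at ha
  rw [h.a_eq_zero_iff _ hv]
  have := h.neg
  linarith

theorem IsContractible.le_of_a_eq_zero (h : G.IsContractible v) {K : G.Char} {E : Finset V}
    (hv : v ∉ E) (ha : a v K (insert v E) = 0) : G.framing v ≤ K.1 v := by
  rw [h.a_eq_zero_iff _ hv] at ha
  have := h.neg
  rcases typeSign_eq (v := v) K E with h4 | h4 <;> rw [h4] at ha <;> omega

theorem IsContractible.lt_of_a_ne_zero (h : G.IsContractible v) {K : G.Char} {E : Finset V}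
    (hv : v ∉ E) (ha : a v K (insert v E) ≠ 0) : K.1 v < -G.framing v := by
  rw [Ne, h.a_eq_zero_iff _ hv] at ha
  have := h.neg
  rcases typeSign_eq (v := v) K E with h4 | h4 <;> rw [h4] at ha <;> omega

theorem H₀_gen_of_mem {K : G.Char} {E : Finset V} (hv : v ∈ E) : G.H₀ v (gen 0 K E) = 0 := by
  rw [H₀, lift_gen_zero, if_pos hv]

/-- K(v) < (T−2)k says that K − 2v^*, with value K(v) + 2k at v, lies below the threshold Tk. The
only generator of the column sent to 0 is the one at which a_v first becomes nonzero, a peak of the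
weight. -/
theorem IsContractible.H₀_gen (h : G.IsContractible v) (K : G.Char) {E : Finset V} (hv : v ∉ E) :
    G.H₀ v (gen 0 K E) =
      if a v K (insert v E) = 0 then gen 0 K (insert v E)
      else if a v (K.shift (-G.dual v)) (insert v E) = 0 then 0
      else gen 0 (K.shift (-G.dual v)) (insert v E) := by
  have h1 : typeSign v (K.shift (-G.dual v)) E = typeSign v K E := by
    rw [← typeSign_shift h.neg, Char.shift_neg_shift]
  have h2 : (K.shift (-G.dual v)).1 v = K.1 v - 2 * G.framing v := by
    rw [Char.shift_apply, Pi.neg_apply, dual_self]; ring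
  have h3 : a v (K.shift (-G.dual v)) (insert v E) = 0 ↔
      ¬ K.1 v < (typeSign v K E - 2) * (-G.framing v) := by
    rw [h.a_eq_zero_iff _ hv, h1, h2, not_lt]
    constructor <;> intro h <;> linarith
  rw [H₀, lift_gen_zero, if_neg hv]
  simp only [h3, h.a_eq_zero_iff K hv, ite_not]

theorem b_eq_zero_of_a_ne_zero (K : G.Char) {E : Finset V}
    (ha : a v K (insert v E) ≠ 0) : b v K (insert v E) = 0 := by
  have h3 := min_a_b v K (insert v E) (Finset.mem_insert_self v E)
  omega

end Columns

end PlumbingGraph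

namespace PlumbingGraph

open Polynomial Filter

/-! ### Convergence of the contraction -/

section Contraction

variable {V : Type u} [Fintype V] [DecidableEq V] {G : PlumbingGraph V} {v : V}

/-- The part of `CF⁻(G)` spanned by the `[K,E]` with `v ∈ E`. -/
def containing (G : PlumbingGraph V) (v : V) : Submodule (ZMod 2)[X] G.CF :=
  Finsupp.supported _ _ {c | v ∈ c.2}

theorem gen_mem_containing (n : ℕ) (K : G.Char) {E : Finset V} (hv : v ∈ E) :
    gen n K E ∈ G.containing v :=
  Finsupp.single_mem_supported _ _ hv

theorem map_mem_of_mem_containing {N : Type*} [AddCommGroup N] [Module (ZMod 2)[X] N]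
    {φ : G.CF →ₗ[(ZMod 2)[X]] N} {S : Submodule (ZMod 2)[X] N}
    (h : ∀ K E, v ∈ E → φ (gen 0 K E) ∈ S) {x : G.CF} (hx : x ∈ G.containing v) : φ x ∈ S :=
  mem_of_gen_mem φ S fun c hc => h c.1 c.2 ((Finsupp.mem_supported _ _).1 hx hc)

theorem H₀_of_mem_containing {x : G.CF} (hx : x ∈ G.containing v) : G.H₀ v x = 0 :=
  (Submodule.mem_bot (ZMod 2)[X]).1 (map_mem_of_mem_containing
    (fun _ _ hv => (Submodule.mem_bot _).2 (H₀_gen_of_mem hv)) hx)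

theorem H₀_mem_containing (x : G.CF) : G.H₀ v x ∈ G.containing v := by
  refine mem_of_gen_mem _ _ fun c _ => ?_
  rw [H₀, lift_gen_zero]
  split_ifs
  · exact Submodule.zero_mem _
  · exact gen_mem_containing _ _ (Finset.mem_insert_self _ _)
  · exact gen_mem_containing _ _ (Finset.mem_insert_self _ _)
  · exact Submodule.zero_mem _

theorem exists_boundary_eq (K : G.Char) {E : Finset V} (hv : v ∉ E) :
    ∃ s ∈ G.containing v, G.boundary (gen 0 K (insert v E)) =
      gen (a v K (insert v E)).toNat K E +
        gen (b v K (insert v E)).toNat (K.shift (G.dual v)) E + s := by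
  refine ⟨∑ w ∈ E, (gen (a w K (insert v E)).toNat K ((insert v E).erase w) +
      gen (b w K (insert v E)).toNat (K.shift (G.dual w)) ((insert v E).erase w)), ?_, ?_⟩
  · refine Submodule.sum_mem _ fun w hw => ?_
    have h : v ∈ (insert v E).erase w :=
      Finset.mem_erase.2 ⟨fun h => hv (h ▸ hw), Finset.mem_insert_self _ _⟩
    exact Submodule.add_mem _ (gen_mem_containing _ _ h) (gen_mem_containing _ _ h)
  · rw [boundary_gen_zero, Finset.sum_insert hv, Finset.erase_insert hv]

theorem C₀_apply (x : G.CF) : G.C₀ v x = x + G.boundary (G.H₀ v x) + G.H₀ v (G.boundary x) := rfl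

theorem C₀_gen_insert (K : G.Char) {E : Finset V} (hv : v ∉ E) :
    G.C₀ v (gen 0 K (insert v E)) = gen 0 K (insert v E) +
      ((X ^ (a v K (insert v E)).toNat : (ZMod 2)[X]) • G.H₀ v (gen 0 K E) +
      (X ^ (b v K (insert v E)).toNat : (ZMod 2)[X]) •
        G.H₀ v (gen 0 (K.shift (G.dual v)) E)) := by
  obtain ⟨s, hs, h⟩ := exists_boundary_eq K hv
  rw [C₀_apply, H₀_gen_of_mem (Finset.mem_insert_self _ _), map_zero, add_zero, h, map_add, map_add,
    H₀_of_mem_containing hs, add_zero, gen_eq_smul (a v K _).toNat, gen_eq_smul (b v K _).toNat,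
    map_smul, map_smul]

theorem shift_dual_shift_neg (K : G.Char) : (K.shift (G.dual v)).shift (-G.dual v) = K := by
  rw [Char.shift_comm, Char.shift_neg_shift]

namespace IsContractible

/-- In C₀ of a cube containing v, the cube itself cancels against one face term. There remains at
most a U-multiple of the neighbour one step nearer the peak; since K(v) is bounded on that side, the
process ends in 0. -/
theorem gen_insert_mem (h : G.IsContractible v) (K : G.Char) {E : Finset V} (hv : v ∉ E) :
    gen 0 K (insert v E) ∈ locallyNilpotentPart (G.C₀ v) := by
  have hn := h.neg
  by_cases ha : a v K (insert v E) = 0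
  · induction hm : (K.1 v - G.framing v).toNat using Nat.strong_induction_on generalizing K with
    | _ m ih =>
      have h1 := h.le_of_a_eq_zero hv ha
      refine mem_locallyNilpotentPart_of_apply ?_
      rw [C₀_gen_insert K hv, h.H₀_gen K hv, if_pos ha, h.H₀_gen _ hv, shift_dual_shift_neg,
        if_pos ha, ha, Int.toNat_zero, pow_zero, one_smul, ← add_assoc, add_self_eq_zero_of_poly,
        zero_add]
      refine Submodule.smul_mem _ _ ?_
      split_ifs with ha'
      · refine ih _ ?_ _ ha' rfl
        have h2 := h.le_of_a_eq_zero hv ha'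
        rw [Char.shift_apply, dual_self] at h2 ⊢
        omega
      · exact Submodule.zero_mem _
  · induction hm : (-G.framing v - K.1 v).toNat using Nat.strong_induction_on generalizing K with
    | _ m ih =>
      have h1 := h.lt_of_a_ne_zero hv ha
      have h2 : a v (K.shift (G.dual v)) (insert v E) ≠ 0 :=
        fun h3 => ha (h.a_eq_zero_of_shift hv h3)
      refine mem_locallyNilpotentPart_of_apply ?_
      rw [C₀_gen_insert K hv, h.H₀_gen K hv, if_neg ha, h.H₀_gen _ hv, shift_dual_shift_neg,
        if_neg h2, if_neg ha, b_eq_zero_of_a_ne_zero K ha, Int.toNat_zero, pow_zero, one_smul,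
        add_comm, add_assoc, add_self_eq_zero_of_poly, add_zero]
      refine Submodule.smul_mem _ _ ?_
      split_ifs with ha'
      · exact Submodule.zero_mem _
      · refine ih _ ?_ _ ha' rfl
        rw [Char.shift_apply, Pi.neg_apply, dual_self]
        omega

theorem containing_le (h : G.IsContractible v) :
    G.containing v ≤ locallyNilpotentPart (G.C₀ v) := by
  intro x hx
  refine map_mem_of_mem_containing (φ := LinearMap.id) (fun K E hv => ?_) hx
  rw [← Finset.insert_erase hv]
  exact h.gen_insert_mem K (Finset.notMem_erase v E)

/-- Terms containing `v` are killed by a power of C₀, so stability of C₀x only has to be known for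
its main term `y`. -/
theorem mem_stablePart_of_boundary_H₀ (h : G.IsContractible v) {x y : G.CF}
    (hy : y ∈ stablePart (G.C₀ v)) (hx : x + G.boundary (G.H₀ v x) - y ∈ G.containing v) :
    x ∈ stablePart (G.C₀ v) := by
  refine mem_stablePart_of_apply ?_
  have h1 : G.C₀ v x = y + ((x + G.boundary (G.H₀ v x) - y) + G.H₀ v (G.boundary x)) := by
    rw [C₀_apply]; abel
  rw [h1]
  exact Submodule.add_mem _ hy (locallyNilpotentPart_le_stablePart _
    (h.containing_le (Submodule.add_mem _ hx (H₀_mem_containing _))))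

/-- Modulo cubes containing v, C₀ replaces [K,E] by a power of U times its neighbour towards the
peak, and fixes the generator on which H₀ vanishes. -/
theorem gen_mem_stablePart (h : G.IsContractible v) (K : G.Char) {E : Finset V} (hv : v ∉ E) :
    gen 0 K E ∈ stablePart (G.C₀ v) := by
  have hn := h.neg
  by_cases ha : a v K (insert v E) = 0
  · induction hm : (K.1 v - G.framing v).toNat using Nat.strong_induction_on generalizing K with
    | _ m ih =>
      have h1 := h.le_of_a_eq_zero hv ha
      obtain ⟨s, hs, hb⟩ := exists_boundary_eq K hv
      refine h.mem_stablePart_of_boundary_H₀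
        (y := (X ^ (b v K (insert v E)).toNat : (ZMod 2)[X]) • gen 0 (K.shift (G.dual v)) E)
        (Submodule.smul_mem _ _ ?_) ?_
      · by_cases ha' : a v (K.shift (G.dual v)) (insert v E) = 0
        · refine ih _ ?_ _ ha' rfl
          have h2 := h.le_of_a_eq_zero hv ha'
          rw [Char.shift_apply, dual_self] at h2 ⊢
          omega
        -- The neighbour is the peak where H₀ vanishes, so the induction stops here.
        · have h2 : G.H₀ v (gen 0 (K.shift (G.dual v)) E) = 0 := by
            rw [h.H₀_gen _ hv, if_neg ha', shift_dual_shift_neg, if_pos ha]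
          rw [mem_stablePart, C₀_apply, h2, map_zero, add_zero, add_sub_cancel_left]
          exact h.containing_le (H₀_mem_containing _)
      · rw [h.H₀_gen K hv, if_pos ha, hb, ha, Int.toNat_zero, X_pow_smul_gen, add_zero]
        convert hs using 1
        rw [← add_assoc, ← add_assoc, add_self_eq_zero_of_poly, zero_add, add_sub_cancel_left]
  · induction hm : (-G.framing v - K.1 v).toNat using Nat.strong_induction_on generalizing K with
    | _ m ih =>
      have h1 := h.lt_of_a_ne_zero hv ha
      by_cases ha' : a v (K.shift (-G.dual v)) (insert v E) = 0
      · have h2 : G.H₀ v (gen 0 K E) = 0 := by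
          rw [h.H₀_gen _ hv, if_neg ha, if_pos ha']
        rw [mem_stablePart, C₀_apply, h2, map_zero, add_zero, add_sub_cancel_left]
        exact h.containing_le (H₀_mem_containing _)
      · obtain ⟨s, hs, hb⟩ := exists_boundary_eq (K.shift (-G.dual v)) hv
        refine h.mem_stablePart_of_boundary_H₀
          (y := (X ^ (a v (K.shift (-G.dual v)) (insert v E)).toNat : (ZMod 2)[X]) •
            gen 0 (K.shift (-G.dual v)) E) (Submodule.smul_mem _ _ ?_) ?_
        · refine ih _ ?_ _ ha' rfl
          rw [Char.shift_apply, Pi.neg_apply, dual_self]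
          omega
        · rw [h.H₀_gen K hv, if_neg ha, if_neg ha', hb, b_eq_zero_of_a_ne_zero _ ha',
            Int.toNat_zero, X_pow_smul_gen, add_zero, Char.shift_neg_shift]
          convert hs using 1
          rw [add_comm (gen _ _ _) (gen 0 K E), add_assoc, ← add_assoc (gen 0 K E),
            add_self_eq_zero_of_poly, zero_add, add_sub_cancel_left]

theorem stablePart_eq_top (h : G.IsContractible v) : stablePart (G.C₀ v) = ⊤ := by
  refine eq_top_iff.2 fun x _ => ?_
  refine mem_of_gen_mem LinearMap.id _ fun c _ => ?_
  by_cases hv : v ∈ c.2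
  · exact locallyNilpotentPart_le_stablePart _ (h.containing_le (gen_mem_containing _ _ hv))
  · exact h.gen_mem_stablePart _ hv

theorem exists_pow_succ_eq (h : G.IsContractible v) (x : G.CF) :
    ∃ n : ℕ, (G.C₀ v ^ (n + 1)) x = (G.C₀ v ^ n) x :=
  exists_pow_succ_eq_of_mem_stablePart (h.stablePart_eq_top ▸ Submodule.mem_top)

/-- `contraction` chooses a stabilization index for each generator. The pointwise limit of the
iterates is linear and agrees with it on generators, hence everywhere. -/
theorem eventually_contraction (h : G.IsContractible v) (x : G.CF) :
    ∀ᶠ n in atTop, (G.C₀ v ^ n) x = G.contraction v x := by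
  obtain ⟨F, hF⟩ := exists_eventual_limit (fun n => G.C₀ v ^ n) fun x => by
    obtain ⟨n, hn⟩ := h.exists_pow_succ_eq x
    exact ⟨_, eventually_atTop.2 ⟨n, fun m hm => pow_eq_of_pow_succ_eq hn hm⟩⟩
  have hFc : F = G.contraction v := by
    refine hom_ext fun K E => ?_
    have hex := h.exists_pow_succ_eq (gen 0 K E)
    obtain ⟨n, h1, h2⟩ := ((hF (gen 0 K E)).and (eventually_ge_atTop hex.choose)).exists
    rw [← h1, contraction, lift_gen_zero, dif_pos hex]
    exact pow_eq_of_pow_succ_eq hex.choose_spec h2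
  rw [← hFc]
  exact hF x

theorem contraction_of_mem_containing (h : G.IsContractible v) {x : G.CF}
    (hx : x ∈ G.containing v) : G.contraction v x = 0 := by
  obtain ⟨n, h1, h2⟩ := ((h.eventually_contraction x).and (h.containing_le hx)).exists
  rw [← h1, h2]

/-- The series ∑ C₀^m H₀ is finite on each element, because H₀ lands in the cubes containing v,
where C₀ is locally nilpotent. -/
theorem exists_homotopy (h : G.IsContractible v) :
    ∃ η : G.CF →ₗ[(ZMod 2)[X]] G.CF, ∀ x, ∀ᶠ n in atTop,
    (∑ m ∈ range n, G.C₀ v ^ m) (G.H₀ v x) = η x := by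
  refine exists_eventual_limit (fun n => (∑ m ∈ range n, G.C₀ v ^ m) ∘ₗ G.H₀ v) fun x => ?_
  obtain ⟨N, hN⟩ := eventually_atTop.1 (h.containing_le (H₀_mem_containing x))
  refine ⟨(∑ m ∈ range N, G.C₀ v ^ m) (G.H₀ v x), eventually_atTop.2 ⟨N, fun n hn => ?_⟩⟩
  rw [LinearMap.comp_apply, LinearMap.sum_apply, LinearMap.sum_apply,
    ← Finset.sum_subset (Finset.range_subset_range.2 hn) fun m _ hm =>
      hN m (not_lt.1 fun h => hm (Finset.mem_range.2 h))]

end IsContractible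

theorem boundary_boundary (hneg : G.NegDef) (x : G.CF) : G.boundary (G.boundary x) = 0 :=
  LinearMap.congr_fun (boundary_sq hneg) x

theorem C₀_boundary (hneg : G.NegDef) (x : G.CF) :
    G.C₀ v (G.boundary x) = G.boundary (G.C₀ v x) := by
  simp only [C₀_apply, map_add, boundary_boundary hneg, map_zero, add_zero]

theorem C₀_pow_boundary (hneg : G.NegDef) (n : ℕ) (x : G.CF) :
    (G.C₀ v ^ n) (G.boundary x) = G.boundary ((G.C₀ v ^ n) x) := by
  induction n with
  | zero => rfl
  | succ n ih => simp only [pow_succ', Module.End.mul_apply, ih, C₀_boundary hneg]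

/-- Telescoping: C₀^(n+1) − C₀^n = C₀^n(∂H₀ + H₀∂), and C₀ commutes with ∂. -/
theorem C₀_pow_sub (hneg : G.NegDef) (n : ℕ) (x : G.CF) :
    (G.C₀ v ^ n) x - x = G.boundary ((∑ m ∈ range n, G.C₀ v ^ m) (G.H₀ v x)) +
      (∑ m ∈ range n, G.C₀ v ^ m) (G.H₀ v (G.boundary x)) := by
  induction n with
  | zero => simp
  | succ n ih =>
    have h1 : (G.C₀ v ^ (n + 1)) x = (G.C₀ v ^ n) x + G.boundary ((G.C₀ v ^ n) (G.H₀ v x)) +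
        (G.C₀ v ^ n) (G.H₀ v (G.boundary x)) := by
      rw [pow_succ, Module.End.mul_apply, C₀_apply, map_add, map_add, C₀_pow_boundary hneg]
    rw [Finset.sum_range_succ, LinearMap.add_apply, LinearMap.add_apply, map_add, h1]
    rw [sub_eq_iff_eq_add] at ih
    rw [ih]
    abel

theorem IsContractible.contraction_boundary (h : G.IsContractible v) (hneg : G.NegDef)
    (x : G.CF) : G.contraction v (G.boundary x) = G.boundary (G.contraction v x) := by
  obtain ⟨n, h1, h2⟩ := ((h.eventually_contraction x).and
    (h.eventually_contraction (G.boundary x))).exists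
  rw [← h1, ← h2, C₀_pow_boundary hneg]

end Contraction

end PlumbingGraph

/-! ### The contraction is filtered -/

namespace PlumbingGraph

open Polynomial Filter

section FilteredContraction

theorem dual₀_attach {V : Type u} [DecidableEq V] (G : PlumbingGraph V) (v w : V) :
    (G.attach v).dual₀ w = if w = v then 1 else 0 := by
  simp [UnframedGraph.dual₀]

variable {V : Type u} [Fintype V] [DecidableEq V] {G : PlumbingGraph V} {v : V}

theorem g_shift_of_eq_zero (K : G.Char) {E : Finset V} {y : V → ℤ} (h : ∀ w ∈ E, y w = 0) :
    g (K.shift y) E = g K E := by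
  unfold g
  refine Finset.inf'_congr _ rfl fun I hI => ?_
  have h1 := two_mul_f K I
  have h2 := two_mul_f (K.shift y) I
  have h3 : ∑ w ∈ I, (K.shift y).1 w = ∑ w ∈ I, K.1 w := Finset.sum_congr rfl fun w hw => by
    rw [Char.shift_apply, h w (Finset.mem_powerset.1 hI hw), mul_zero, add_zero]
  omega

theorem weight_shift_dual₀ (K : G.Char) {E : Finset V} (hv : v ∉ E) :
    weight (K.shift (G.attach v).dual₀) E =
      weight K E + (quad (K.shift (G.attach v).dual₀) - quad K) := by
  unfold weight
  rw [g_shift_of_eq_zero]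
  · ring
  · intro w hw
    rw [dual₀_attach, if_neg fun h : w = v => hv (h ▸ hw)]

/-- Since v₀^*(v) = 1, the v₀-shift raises f[K,{v}] by one. This is the unit tilt along the column.
-/
theorem quad_shift_dual₀_shift_dual (hneg : G.NegDef) (K : G.Char) :
    quad ((K.shift (G.dual v)).shift (G.attach v).dual₀) - quad (K.shift (G.dual v)) =
      quad (K.shift (G.attach v).dual₀) - quad K + 1 := by
  have h1 := two_mul_f_singleton (K.shift (G.attach v).dual₀) v
  have h2 := two_mul_f_singleton K v
  rw [Char.shift_apply, dual₀_attach, if_pos rfl] at h1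
  have h3 : f (K.shift (G.attach v).dual₀) {v} = f K {v} + 1 := by omega
  rw [Char.shift_comm, quad_shift_dual hneg, quad_shift_dual hneg, h3]
  push_cast
  ring

theorem weight_shift_dual₀_shift_dual (hneg : G.NegDef) (K : G.Char) {E : Finset V}
    (hv : v ∉ E) :
    weight ((K.shift (G.dual v)).shift (G.attach v).dual₀) E =
      weight (K.shift (G.dual v)) E + (quad (K.shift (G.attach v).dual₀) - quad K) + 1 := by
  rw [weight_shift_dual₀ _ hv, quad_shift_dual₀_shift_dual hneg]
  ring

theorem weight_insert_front (K : G.Char) {E : Finset V} (hv : v ∉ E) :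
    weight K E = weight K (insert v E) + a v K (insert v E) := by
  rw [← weight_front, Finset.erase_insert hv]

theorem weight_insert_back (hneg : G.NegDef) (K : G.Char) {E : Finset V} (hv : v ∉ E) :
    weight (K.shift (G.dual v)) E = weight K (insert v E) + b v K (insert v E) := by
  rw [← weight_back hneg, Finset.erase_insert hv]

theorem weight_insert (hneg : G.NegDef) (K : G.Char) {E : Finset V} (hv : v ∉ E) :
    weight K (insert v E) = min (weight K E) (weight (K.shift (G.dual v)) E) := by
  rw [weight_eq_min hneg K (Finset.mem_insert_self v E), Finset.erase_insert hv]

theorem weight_insert_shift_dual₀ (hneg : G.NegDef) (K : G.Char) {E : Finset V} (hv : v ∉ E) :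
    weight (K.shift (G.attach v).dual₀) (insert v E) =
      min (weight K E) (weight (K.shift (G.dual v)) E + 1) +
        (quad (K.shift (G.attach v).dual₀) - quad K) := by
  rw [weight_insert hneg _ hv, weight_shift_dual₀ _ hv, Char.shift_comm,
    weight_shift_dual₀_shift_dual hneg _ hv, ← min_add_add_right]
  congr 1
  ring

theorem alexander_attach (hneg : G.NegDef) (v : V) (m₀ : ℤ) (K : G.Char) (E : Finset V) :
    (G.attach v).alexander m₀ K E = weight K E - weight (K.shift (G.attach v).dual₀) E :=
  (G.attach v).alexander_eq hneg m₀ K E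

theorem b_insert_nonneg (K : G.Char) (E : Finset V) : (0 : ℚ) ≤ b v K (insert v E) := by
  exact_mod_cast b_nonneg v K _ (Finset.mem_insert_self v E)

/-- The tilted minimum over the new edge is attained at the same end as the untilted one, so the
Alexander grading is unchanged. -/
theorem IsContractible.H₀_isFiltered (h : G.IsContractible v) (hneg : G.NegDef) (m₀ : ℤ) :
    IsFiltered ((G.attach v).alexanderFiltration m₀) ((G.attach v).alexanderFiltration m₀)
      (G.H₀ v) := by
  refine (G.attach v).isFiltered_of_gen m₀ fun K E => ?_
  by_cases hv : v ∈ E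
  · rw [H₀_gen_of_mem hv]
    exact Submodule.zero_mem _
  rw [h.H₀_gen K hv]
  split_ifs with ha ha'
  · refine (G.attach v).gen_mem_alexanderFiltration m₀ ?_
    have h1 := weight_insert_front K hv
    have h2 := weight_insert_back hneg K hv
    have h3 := b_insert_nonneg (v := v) K E
    rw [ha, Int.cast_zero, add_zero] at h1
    rw [alexander_attach hneg, alexander_attach hneg,
      weight_insert_shift_dual₀ hneg K hv, weight_shift_dual₀ K hv, min_eq_left (by linarith)]
    push_cast
    linarith
  · exact Submodule.zero_mem _
  · refine (G.attach v).gen_mem_alexanderFiltration m₀ ?_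
    set L := K.shift (-G.dual v) with hL
    have hK : K = L.shift (G.dual v) := (Char.shift_neg_shift K _).symm
    have h1 := weight_insert_front L hv
    have h2 := weight_insert_back hneg L hv
    -- Integrality: a nonzero increment is at least 1, which pays for the unit tilt.
    have h3 : (1 : ℚ) ≤ a v L (insert v E) := by
      have := a_nonneg v L (insert v E)
      exact_mod_cast (by omega : 1 ≤ a v L (insert v E))
    rw [b_eq_zero_of_a_ne_zero L ha', Int.cast_zero, add_zero] at h2
    rw [alexander_attach hneg, alexander_attach hneg,
      weight_insert_shift_dual₀ hneg L hv, hK, weight_shift_dual₀_shift_dual hneg L hv,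
      min_eq_right (by linarith)]
    push_cast
    linarith

theorem H₀_hasDegree : HasDegree 1 G.deltaPart G.deltaPart (G.H₀ v) := by
  refine hasDegree_of_gen fun K E => ?_
  rw [H₀, lift_gen_zero]
  have h : v ∉ E → (E.card : ℤ) + 1 = ((insert v E).card : ℤ) := fun hv => by
    rw [Finset.card_insert_of_notMem hv]; push_cast; rfl
  split_ifs with hv
  · exact Submodule.zero_mem _
  · rw [h hv]; exact gen_mem_deltaPart _ _ _
  · rw [h hv]; exact gen_mem_deltaPart _ _ _
  · exact Submodule.zero_mem _

theorem C₀_mem_deltaPart {k : ℤ} {x : G.CF} (hx : x ∈ G.deltaPart k) :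
    G.C₀ v x ∈ G.deltaPart k := by
  rw [C₀_apply]
  refine Submodule.add_mem _ (Submodule.add_mem _ hx ?_) ?_
  · simpa using boundary_hasDegree _ _ (H₀_hasDegree (v := v) k x hx)
  · simpa using H₀_hasDegree (v := v) _ _ (boundary_hasDegree k x hx)

theorem pow_mem_of_mem {R M S : Type*} [CommRing R] [AddCommGroup M] [Module R M] [SetLike S M]
    {s : S} {T : M →ₗ[R] M} (h : ∀ x ∈ s, T x ∈ s) (n : ℕ) {x : M} (hx : x ∈ s) :
    (T ^ n) x ∈ s := by
  induction n with
  | zero => exact hx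
  | succ n ih => rw [pow_succ', Module.End.mul_apply]; exact h _ ih

namespace IsContractible

theorem contraction_mem (h : G.IsContractible v) {S : Type*} [SetLike S G.CF] {s : S}
    (hs : ∀ x ∈ s, G.C₀ v x ∈ s) {x : G.CF} (hx : x ∈ s) : G.contraction v x ∈ s := by
  obtain ⟨n, hn⟩ := (h.eventually_contraction x).exists
  rw [← hn]
  exact pow_mem_of_mem hs n hx

theorem contraction_hasDegree (h : G.IsContractible v) :
    HasDegree 0 G.deltaPart G.deltaPart (G.contraction v) := by
  intro k x hx
  rw [add_zero]
  exact h.contraction_mem (fun _ => C₀_mem_deltaPart) hx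

theorem C₀_isFiltered (h : G.IsContractible v) (hneg : G.NegDef) (m₀ : ℤ) :
    IsFiltered ((G.attach v).alexanderFiltration m₀) ((G.attach v).alexanderFiltration m₀)
      (G.C₀ v) := by
  intro i x hx
  have h1 := h.H₀_isFiltered hneg m₀
  have h2 := (G.attach v).boundary_isFiltered m₀ hneg
  rw [C₀_apply]
  exact Submodule.add_mem _ (Submodule.add_mem _ hx (h2 _ _ (h1 _ _ hx))) (h1 _ _ (h2 _ _ hx))

theorem contraction_isFiltered (h : G.IsContractible v) (hneg : G.NegDef) (m₀ : ℤ) :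
    IsFiltered ((G.attach v).alexanderFiltration m₀) ((G.attach v).alexanderFiltration m₀)
      (G.contraction v) :=
  fun i _ hx => h.contraction_mem (h.C₀_isFiltered hneg m₀ i) hx

theorem contraction_homotopic (h : G.IsContractible v) (hneg : G.NegDef) (m₀ : ℤ) :
    ∃ η : G.CF →ₗ[(ZMod 2)[X]] G.CF, HasDegree 1 G.deltaPart G.deltaPart η ∧
      IsFiltered ((G.attach v).alexanderFiltration m₀) ((G.attach v).alexanderFiltration m₀) η ∧
      ∀ x, G.contraction v x = x + G.boundary (η x) + η (G.boundary x) := by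
  obtain ⟨η, hη⟩ := h.exists_homotopy
  have hsum : ∀ n : ℕ, ∀ x, (∑ m ∈ range n, G.C₀ v ^ m) (G.H₀ v x) =
      ∑ m ∈ range n, (G.C₀ v ^ m) (G.H₀ v x) := fun n x => LinearMap.sum_apply _ _ _
  refine ⟨η, fun k x hx => ?_, fun i x hx => ?_, fun x => ?_⟩
  · obtain ⟨n, hn⟩ := (hη x).exists
    rw [← hn, hsum]
    exact Submodule.sum_mem _ fun m _ => pow_mem_of_mem (fun _ => C₀_mem_deltaPart) m
      (H₀_hasDegree k x hx)
  · obtain ⟨n, hn⟩ := (hη x).exists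
    rw [← hn, hsum]
    exact Submodule.sum_mem _ fun m _ => pow_mem_of_mem (h.C₀_isFiltered hneg m₀ i) m
      (h.H₀_isFiltered hneg m₀ i x hx)
  · obtain ⟨n, ⟨h1, h2⟩, h3⟩ := (((h.eventually_contraction x).and (hη x)).and
      (hη (G.boundary x))).exists
    have h4 := C₀_pow_sub (v := v) hneg n x
    rw [h1, h2, h3, sub_eq_iff_eq_add] at h4
    rw [h4]
    abel

end IsContractible

/-- Apply C_v to ∂[K, E ∪ v]. As C_v commutes with ∂ and kills cubes containing v, only the two
v-faces are left. -/
theorem IsContractible.contraction_column (h : G.IsContractible v) (hneg : G.NegDef)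
    (K : G.Char) {E : Finset V} (hv : v ∉ E) :
    (X ^ (a v K (insert v E)).toNat : (ZMod 2)[X]) • G.contraction v (gen 0 K E) =
      (X ^ (b v K (insert v E)).toNat : (ZMod 2)[X]) •
        G.contraction v (gen 0 (K.shift (G.dual v)) E) := by
  obtain ⟨s, hs, hb⟩ := exists_boundary_eq K hv
  have h1 := h.contraction_boundary hneg (gen 0 K (insert v E))
  rw [h.contraction_of_mem_containing (gen_mem_containing 0 K (Finset.mem_insert_self v E)),
    map_zero, hb, map_add, map_add, h.contraction_of_mem_containing hs, add_zero, gen_eq_smul,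
    gen_eq_smul (b v K _).toNat, map_smul, map_smul, ← sub_eq_add_of_poly, sub_eq_zero] at h1
  exact h1

/-- The contractions of two cubes of a column agree up to the powers of `U` that the weights
prescribe. -/
theorem IsContractible.contraction_shift (h : G.IsContractible v) (hneg : G.NegDef)
    (K : G.Char) {E : Finset V} (hv : v ∉ E) (i : ℤ) :
    ∃ n m : ℕ, (n : ℚ) + weight (K.shift (i • G.dual v)) E = m + weight K E ∧
      (X ^ n : (ZMod 2)[X]) • G.contraction v (gen 0 K E) =
        (X ^ m : (ZMod 2)[X]) • G.contraction v (gen 0 (K.shift (i • G.dual v)) E) := by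
  have step : ∀ L : G.Char, ∃ n m : ℕ, (n : ℚ) + weight (L.shift (G.dual v)) E = m + weight L E ∧
      (X ^ n : (ZMod 2)[X]) • G.contraction v (gen 0 L E) =
        (X ^ m : (ZMod 2)[X]) • G.contraction v (gen 0 (L.shift (G.dual v)) E) := fun L => by
    refine ⟨_, _, ?_, h.contraction_column hneg L hv⟩
    have h1 := weight_insert_front L hv
    have h2 := weight_insert_back hneg L hv
    have h3 : (((a v L (insert v E)).toNat : ℤ) : ℚ) = a v L (insert v E) := by
      rw [Int.toNat_of_nonneg (a_nonneg _ _ _)]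
    have h4 : (((b v L (insert v E)).toNat : ℤ) : ℚ) = b v L (insert v E) := by
      rw [Int.toNat_of_nonneg (b_nonneg _ _ _ (Finset.mem_insert_self v E))]
    rw [Int.cast_natCast] at h3 h4
    rw [h3, h4]
    linarith
  induction i using Int.induction_on with
  | zero => exact ⟨0, 0, by rw [zero_smul, Char.shift_zero], by rw [zero_smul, Char.shift_zero]⟩
  | succ i ih =>
    obtain ⟨n, m, h1, h2⟩ := ih
    obtain ⟨n', m', h3, h4⟩ := step (K.shift ((i : ℤ) • G.dual v))
    rw [Char.shift_shift, show (i : ℤ) • G.dual v + G.dual v = ((i : ℤ) + 1) • G.dual v by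
      rw [add_smul, one_smul]] at h3 h4
    refine ⟨n' + n, m + m', by push_cast; linarith, ?_⟩
    rw [pow_add, mul_smul, h2, pow_add, mul_smul, smul_comm, h4]
  | pred i ih =>
    obtain ⟨n, m, h1, h2⟩ := ih
    -- The step starts one place further back and is read in the opposite direction, so n' and m'
    -- trade roles.
    obtain ⟨n', m', h3, h4⟩ := step (K.shift ((-(i : ℤ) - 1) • G.dual v))
    rw [Char.shift_shift, show (-(i : ℤ) - 1) • G.dual v + G.dual v = (-(i : ℤ)) • G.dual v by
      rw [sub_smul, one_smul, sub_add_cancel]] at h3 h4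
    refine ⟨m' + n, m + n', by push_cast; linarith, ?_⟩
    rw [pow_add, mul_smul, h2, pow_add, mul_smul, smul_comm, h4]

end FilteredContraction

end PlumbingGraph

/-! ### Weights on a blow-up -/

namespace PlumbingGraph

open Polynomial Function

section Matrix

variable {V : Type u} [DecidableEq V] (G : PlumbingGraph V) (v : V)

theorem blowUp_M_some_some (w u : V) : (G.blowUp v).M (some w) (some u) =
    G.M w u - if w = u then (if w = v then 1 else 0) else 0 := by
  unfold M
  by_cases h : w = u
  · subst h; simp [blowUp]
  · simp [blowUp, h]; congr

theorem blowUp_M_none_some (w : V) :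
    (G.blowUp v).M none (some w) = if w = v then 1 else 0 := by
  simp [M, blowUp]
  congr

theorem blowUp_M_some_none (w : V) :
    (G.blowUp v).M (some w) none = if w = v then 1 else 0 := by
  simp [M, blowUp]
  congr

theorem blowUp_M_none_none : (G.blowUp v).M none none = -1 := by
  simp [M, blowUp]

theorem blowUp_isContractible :
    (G.blowUp v).IsContractible none where
  neg := by simp [blowUp]
  sum_le := by
    intro J hJ
    have h : ∀ x ∈ J, (G.blowUp v).M none x = if x = some v then 1 else 0 := by
      intro x hx
      cases x with
      | none => exact absurd hx hJ
      | some w => simp [blowUp_M_none_some]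
    rw [Finset.sum_congr rfl h, Finset.sum_ite_eq']
    simp only [blowUp]
    split_ifs <;> norm_num

variable [Fintype V]

theorem blowUp_mulVec_none (x : Option V → ℚ) :
    (G.blowUp v).MQ.mulVec x none = x (some v) - x none := by
  simp only [Matrix.mulVec, dotProduct, Fintype.sum_option, MQ, Matrix.map_apply,
    blowUp_M_none_none, blowUp_M_none_some]
  simp
  ring

theorem blowUp_mulVec_some (x : Option V → ℚ) (w : V) :
    (G.blowUp v).MQ.mulVec x (some w) = G.MQ.mulVec (fun u => x (some u)) w -
      if w = v then x (some v) - x none else 0 := by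
  simp only [Matrix.mulVec, dotProduct, Fintype.sum_option, MQ, Matrix.map_apply,
    blowUp_M_some_none, blowUp_M_some_some, Int.cast_sub, sub_mul, Finset.sum_sub_distrib]
  by_cases h : w = v
  · subst h; simp; ring
  · simp [h]

/-- (v+e)² = m_v and e·(v+e) = 0 in the blown-up form, so the vectors v + e and u ≠ v span a copy of
the form of `G` orthogonal to e. The coordinate along e is then x_e − x_v. -/
theorem blowUp_form (x : Option V → ℚ) :
    x ⬝ᵥ (G.blowUp v).MQ.mulVec x =
      (fun u => x (some u)) ⬝ᵥ G.MQ.mulVec (fun u => x (some u)) -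
        (x (some v) - x none) ^ 2 := by
  simp only [dotProduct, Fintype.sum_option, blowUp_mulVec_none, blowUp_mulVec_some, mul_sub,
    Finset.sum_sub_distrib]
  simp
  ring

end Matrix

/-! ### Characteristic elements, weights, and the maps P and R. -/

section BlowUp

theorem eq_map_eraseNone {V : Type u} [DecidableEq V] {E : Finset (Option V)} (h : none ∉ E) :
    E = (Finset.eraseNone E).map Embedding.some := by
  rw [Finset.map_some_eraseNone, Finset.erase_eq_of_notMem h]

theorem none_notMem_map {V : Type u} (E : Finset V) : (none : Option V) ∉ E.map Embedding.some := by simp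

theorem erase_map_some {V : Type u} [DecidableEq V] (E : Finset V) (w : V) :
    (E.map Embedding.some).erase (some w) = (E.erase w).map Embedding.some :=
  (Finset.map_erase Embedding.some E w).symm

variable {V : Type u} [Fintype V] [DecidableEq V] {G : PlumbingGraph V} {v : V}

/-- Rescaled, the column relation says that C_v is constant on columns; the extra powers of U cancel
because the complex is torsion-free. -/
theorem IsContractible.contraction_hgen (h : G.IsContractible v) (hneg : G.NegDef) {q : ℚ}
    {K : G.Char} {E : Finset V} (hv : v ∉ E) (i : ℤ) (h₁ : Adm q K E)
    (h₂ : Adm q (K.shift (i • G.dual v)) E) :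
    G.contraction v (hgen q K E) = G.contraction v (hgen q (K.shift (i • G.dual v)) E) := by
  obtain ⟨n, m, h3, h4⟩ := h.contraction_shift hneg K hv i
  obtain ⟨n₁, h₁⟩ := h₁
  obtain ⟨n₂, h₂⟩ := h₂
  have h5 : n + n₂ = m + n₁ := by
    have : (n : ℚ) + n₂ = m + n₁ := by linarith
    exact_mod_cast this
  refine smul_X_pow_injective m ?_
  rw [hgen_eq_gen h₁, hgen_eq_gen h₂, gen_eq_smul n₁, gen_eq_smul n₂, map_smul, map_smul,
    smul_smul, ← pow_add, ← h5, add_comm, pow_add, mul_smul, h4, smul_comm]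

theorem NegDef.blowUp (hneg : G.NegDef) (v : V) : (G.blowUp v).NegDef := by
  intro x hx
  rw [blowUp_form]
  by_cases h : (fun u => x (some u)) = 0
  · have h1 : x (some v) = 0 := congrFun h v
    have h2 : x none ≠ 0 := fun h2 => hx (funext fun y => by
      cases y with
      | none => exact h2
      | some u => exact congrFun h u)
    have h3 : 0 < x none ^ 2 := by positivity
    rw [h, zero_dotProduct, h1]
    linarith
  · have := hneg _ h
    have := sq_nonneg (x (some v) - x none)
    linarith

/-- If `x` represents `K`, then j = x_v − x_e and the restriction of `x` represents `K.down`; now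
use the orthogonal splitting. -/
theorem quad_down (hneg : G.NegDef) (K : (G.blowUp v).Char) :
    quad K.down = quad K + (K.1 none : ℚ) ^ 2 / 8 := by
  set x : Option V → ℚ := (G.blowUp v).MQ⁻¹.mulVec K.toRat with hx
  have h1 : (G.blowUp v).MQ.mulVec x = K.toRat := by
    rw [hx, Matrix.mulVec_mulVec, Matrix.mul_nonsing_inv _ (hneg.blowUp v).isUnit_det,
      Matrix.one_mulVec]
  have h2 : (K.1 none : ℚ) = x (some v) - x none := by
    rw [← blowUp_mulVec_none G v, h1]; rfl
  have h3 : G.MQ.mulVec (fun u => x (some u)) = K.down.toRat := by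
    funext w
    have h4 := blowUp_mulVec_some G v x w
    rw [h1] at h4
    have h5 : K.down.toRat w = K.toRat (some w) + if w = v then (K.1 none : ℚ) else 0 := by
      simp only [Char.toRat, Char.down]
      split_ifs <;> simp
    rw [h5, h4, h2]
    ring
  rw [quad_eq (hneg.blowUp v) K x h1, quad_eq hneg _ _ h3, blowUp_form, h2]
  ring

theorem g_map_some (K : (G.blowUp v).Char) {E : Finset V} (hv : v ∉ E) :
    g K (E.map Embedding.some) = g K.down E := by
  refine g_congr K.down K E Embedding.some fun I hI => ?_
  have := two_mul_f_down K I
  rw [if_neg fun h => hv (hI h)] at this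
  omega

theorem weight_map_some (hneg : G.NegDef) (K : (G.blowUp v).Char) {E : Finset V} (hv : v ∉ E) :
    weight K (E.map Embedding.some) = weight K.down E - (K.1 none : ℚ) ^ 2 / 8 := by
  unfold weight
  rw [g_map_some K hv, quad_down hneg]
  ring

theorem down_apply (K : (G.blowUp v).Char) (w : V) :
    K.down.1 w = K.1 (some w) + if w = v then K.1 none else 0 :=
  rfl

theorem up_some (K : G.Char) (w : V) : (K.up v).1 (some w) = K.1 w + if w = v then 1 else 0 :=
  rfl

theorem up_none (K : G.Char) : (K.up v).1 none = -1 := rfl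

theorem down_shift_dual_some (K : (G.blowUp v).Char) (w : V) :
    (K.shift ((G.blowUp v).dual (some w))).down = K.down.shift (G.dual w) := by
  refine Char.ext_iff'.2 fun u => ?_
  simp only [down_apply, Char.shift_apply, dual, blowUp_M_some_some, blowUp_M_some_none]
  split_ifs <;> first | (exfalso; subst_vars; contradiction) | ring

theorem down_shift_dual_none (K : (G.blowUp v).Char) :
    (K.shift ((G.blowUp v).dual none)).down = K.down := by
  refine Char.ext_iff'.2 fun u => ?_
  simp only [down_apply, Char.shift_apply, dual, blowUp_M_none_some, blowUp_M_none_none]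
  split_ifs <;> ring

theorem down_shift_dual₀ (K : (G.blowUp v).Char) :
    (K.shift ((G.blowUp v).attach none).dual₀).down = K.down.shift (G.attach v).dual₀ := by
  refine Char.ext_iff'.2 fun u => ?_
  simp only [down_apply, Char.shift_apply, dual₀_attach]
  split_ifs <;> simp_all
  ring

theorem down_up (K : G.Char) : (K.up v).down = K := by
  refine Char.ext_iff'.2 fun u => ?_
  simp only [down_apply, up_some, up_none]
  split_ifs <;> ring

/-- A step along the e-column lowers the value at e by 2, so (j+1)/2 steps bring it to −1. This is
what makes RP equal to C_e. -/
theorem up_down (K : (G.blowUp v).Char) :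
    K.down.up v = K.shift (((K.1 none + 1) / 2) • (G.blowUp v).dual none) := by
  have h2 : K.1 none % 2 = 1 := K.modEq none
  refine Char.ext_iff'.2 fun u => ?_
  cases u with
  | none =>
    simp only [up_none, Char.shift_apply, Pi.smul_apply, smul_eq_mul, dual, blowUp_M_none_none]
    omega
  | some w =>
    simp only [up_some, down_apply, Char.shift_apply, Pi.smul_apply, smul_eq_mul, dual,
      blowUp_M_none_some]
    split_ifs <;> omega

theorem up_shift_dual_of_ne (K : G.Char) {w : V} (hw : w ≠ v) :
    (K.shift (G.dual w)).up v = (K.up v).shift ((G.blowUp v).dual (some w)) := by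
  refine Char.ext_iff'.2 fun u => ?_
  cases u with
  | none => simp [up_none, Char.shift_apply, dual, blowUp_M_some_none, hw]
  | some u =>
    simp only [up_some, Char.shift_apply, dual, blowUp_M_some_some]
    split_ifs <;> first | (exfalso; subst_vars; contradiction) | ring

/-- Adding 2v^* raises the value at e from −1 to 1, and one step along the e-column restores −1. -/
theorem up_shift_dual_self (K : G.Char) (v : V) :
    (K.shift (G.dual v)).up v =
      ((K.up v).shift ((G.blowUp v).dual (some v))).shift ((G.blowUp v).dual none) := by
  refine Char.ext_iff'.2 fun u => ?_
  cases u with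
  | none => simp [up_none, Char.shift_apply, dual, blowUp_M_some_none, blowUp_M_none_none]
  | some u =>
    simp only [up_some, Char.shift_apply, dual, blowUp_M_some_some, blowUp_M_none_some]
    split_ifs <;> first | (exfalso; subst_vars; contradiction) | ring

theorem up_shift_dual₀ (K : G.Char) :
    (K.shift (G.attach v).dual₀).up v =
      ((K.up v).shift ((G.blowUp v).dual none)).shift ((G.blowUp v).attach none).dual₀ := by
  refine Char.ext_iff'.2 fun u => ?_
  cases u with
  | none => simp [up_none, Char.shift_apply, dual, blowUp_M_none_none, dual₀_attach]
  | some u =>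
    simp only [up_some, Char.shift_apply, dual, blowUp_M_none_some, dual₀_attach]
    split_ifs <;> simp_all
    ring

theorem shift_dual_some_self_none (K : (G.blowUp v).Char) :
    (K.shift ((G.blowUp v).dual (some v))).1 none = K.1 none + 2 := by
  simp [Char.shift_apply, dual, blowUp_M_some_none]

theorem weight_map_some_insert (hneg : G.NegDef) (K : (G.blowUp v).Char) {E : Finset V}
    (hv : v ∉ E) :
    weight K ((insert v E).map Embedding.some) =
      min (weight K.down E - (K.1 none : ℚ) ^ 2 / 8)
        (weight (K.down.shift (G.dual v)) E - ((K.1 none : ℚ) + 2) ^ 2 / 8) := by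
  have h : (some v : Option V) ∉ E.map Embedding.some := by simpa using hv
  rw [Finset.map_insert, Embedding.some_apply, weight_insert (hneg.blowUp v) K h,
    weight_map_some hneg _ hv, weight_map_some hneg _ hv, down_shift_dual_some,
    shift_dual_some_self_none]
  push_cast
  rfl

/-- The values at e on the two ends of a v-edge are −1 and 1, with equal squares, so the correction
is 1/8 on every corner. This explains the choice j = −1 in R. -/
theorem weight_up (hneg : G.NegDef) (K : G.Char) (E : Finset V) :
    weight (K.up v) (E.map Embedding.some) = weight K E - 1 / 8 := by
  by_cases hv : v ∈ E
  · have hv' := Finset.notMem_erase v E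
    rw [← Finset.insert_erase hv, weight_map_some_insert hneg _ hv', weight_insert hneg _ hv',
      down_up, up_none, ← min_sub_sub_right]
    norm_num
  · rw [weight_map_some hneg _ hv, down_up, up_none]
    norm_num

theorem blowDownExponent_eq (hneg : G.NegDef) (K : (G.blowUp v).Char) (E : Finset V) :
    (blowDownExponent K E : ℚ) =
      weight K.down E - weight K (E.map Embedding.some) - 1 / 8 := by
  obtain ⟨c, hc⟩ := eight_dvd K
  have h : (K.1 none : ℚ) ^ 2 - 1 = 8 * c := by exact_mod_cast hc
  unfold blowDownExponent weight
  rw [hc, Int.mul_ediv_cancel_left _ (by norm_num), quad_down hneg]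
  push_cast
  linarith

/-! ### The blow-down map -/

theorem blowDownMap_gen_of_mem {K : (G.blowUp v).Char} {E : Finset (Option V)} (h : none ∈ E) :
    G.blowDownMap v (gen 0 K E) = 0 := by
  rw [blowDownMap, lift_gen_zero, if_pos h]

theorem blowDownMap_gen (K : (G.blowUp v).Char) (E : Finset V) :
    G.blowDownMap v (gen 0 K (E.map Embedding.some)) =
      gen (blowDownExponent K E).toNat K.down E := by
  rw [blowDownMap, lift_gen_zero, if_neg (none_notMem_map E), Finset.eraseNone_map_some]

theorem Adm.down (hneg : G.NegDef) {q : ℚ} {K : (G.blowUp v).Char} {E : Finset V}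
    (h : Adm q K (E.map Embedding.some)) : Adm (q - 1 / 8) K.down E := by
  obtain ⟨n, hn⟩ := h
  obtain ⟨m, hm⟩ := Int.eq_ofNat_of_zero_le (blowDownExponent_nonneg K E)
  have h1 := blowDownExponent_eq hneg K E
  rw [hm] at h1
  refine ⟨n + m, ?_⟩
  push_cast at h1 ⊢
  linarith

theorem Adm.up (hneg : G.NegDef) {q : ℚ} {K : G.Char} {E : Finset V} (h : Adm q K E) :
    Adm (q + 1 / 8) (K.up v) (E.map Embedding.some) := by
  obtain ⟨n, hn⟩ := h
  refine ⟨n, ?_⟩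
  rw [weight_up hneg]
  linarith

theorem blowDownMap_hgen_of_mem {q : ℚ} {K : (G.blowUp v).Char} {E : Finset (Option V)}
    (h : none ∈ E) : G.blowDownMap v (hgen q K E) = 0 := by
  rw [hgen, gen_eq_smul, map_smul, blowDownMap_gen_of_mem h, smul_zero]

theorem blowDownMap_hgen (hneg : G.NegDef) {q : ℚ} {K : (G.blowUp v).Char} {E : Finset V}
    (h : Adm q K (E.map Embedding.some)) :
    G.blowDownMap v (hgen q K (E.map Embedding.some)) = hgen (q - 1 / 8) K.down E := by
  obtain ⟨n, hn⟩ := h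
  obtain ⟨m, hm⟩ := Int.eq_ofNat_of_zero_le (blowDownExponent_nonneg K E)
  have h1 := blowDownExponent_eq hneg K E
  rw [hm] at h1
  rw [hgen_eq_gen hn, gen_eq_smul, map_smul, blowDownMap_gen, hm, Int.toNat_natCast,
    X_pow_smul_gen, hgen_eq_gen (n := n + m)]
  push_cast at h1 ⊢
  linarith

/-- If e ∈ E, the two e-faces have the same image under `down` and cancel mod 2. Otherwise `down`
matches the faces one by one. -/
theorem blowDownMap_comm (hneg : G.NegDef) :
    G.blowDownMap v ∘ₗ (G.blowUp v).boundary = G.boundary ∘ₗ G.blowDownMap v := by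
  refine hom_ext_hgen fun q K E hq => ?_
  simp only [LinearMap.comp_apply]
  rw [boundary_hgen (hneg.blowUp v) hq, map_sum]
  by_cases h : none ∈ E
  · rw [blowDownMap_hgen_of_mem h, map_zero, Finset.sum_eq_single_of_mem none h]
    · have h1 := hq.front none
      have h2 := hq.back (hneg.blowUp v) h
      rw [← Finset.map_some_eraseNone] at h1 h2 ⊢
      rw [map_add, blowDownMap_hgen hneg h1, blowDownMap_hgen hneg h2, down_shift_dual_none,
        add_self_eq_zero_of_poly]
    · intro w _ hw
      have h1 : none ∈ E.erase w := Finset.mem_erase.2 ⟨Ne.symm hw, h⟩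
      rw [map_add, blowDownMap_hgen_of_mem h1, blowDownMap_hgen_of_mem h1, add_zero]
  · obtain ⟨F, rfl⟩ : ∃ F : Finset V, E = F.map Embedding.some := ⟨_, eq_map_eraseNone h⟩
    rw [blowDownMap_hgen hneg hq, boundary_hgen hneg (hq.down hneg), Finset.sum_map]
    refine Finset.sum_congr rfl fun w hw => ?_
    have h1 := hq.front (some w)
    have h2 := hq.back (hneg.blowUp v) (Finset.mem_map_of_mem Embedding.some hw)
    simp only [Embedding.some_apply, erase_map_some] at h1 h2 ⊢
    rw [map_add, blowDownMap_hgen hneg h1, blowDownMap_hgen hneg h2, down_shift_dual_some]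

theorem blowDownMap_boundary (hneg : G.NegDef) :
    ∀ x, G.blowDownMap v ((G.blowUp v).boundary x) = G.boundary (G.blowDownMap v x) :=
  LinearMap.congr_fun (blowDownMap_comm hneg)

theorem blowDownMap_hasDegree :
    HasDegree 0 (G.blowUp v).deltaPart G.deltaPart (G.blowDownMap v) := by
  refine hasDegree_of_gen fun K E => ?_
  rw [add_zero]
  by_cases h : none ∈ E
  · rw [blowDownMap_gen_of_mem h]
    exact Submodule.zero_mem _
  · obtain ⟨F, rfl⟩ : ∃ F : Finset V, E = F.map Embedding.some := ⟨_, eq_map_eraseNone h⟩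
    rw [blowDownMap_gen, Finset.card_map]
    exact gen_mem_deltaPart _ _ _

/-- When e ∉ E, the loss in Alexander grading is the exponent s of the cube shifted by v₀'^*, which
is nonnegative. -/
theorem blowDownMap_isFiltered (hneg : G.NegDef) (m₀ m₀' : ℤ) :
    IsFiltered (((G.blowUp v).attach none).alexanderFiltration m₀')
      ((G.attach v).alexanderFiltration m₀) (G.blowDownMap v) := by
  refine ((G.blowUp v).attach none).isFiltered_of_gen m₀' fun K E => ?_
  by_cases h : none ∈ E
  · rw [blowDownMap_gen_of_mem h]
    exact Submodule.zero_mem _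
  · obtain ⟨F, rfl⟩ : ∃ F : Finset V, E = F.map Embedding.some := ⟨_, eq_map_eraseNone h⟩
    rw [blowDownMap_gen]
    refine (G.attach v).gen_mem_alexanderFiltration m₀ ?_
    obtain ⟨m, hm⟩ := Int.eq_ofNat_of_zero_le (blowDownExponent_nonneg K F)
    have h1 := blowDownExponent_eq hneg K F
    have h2 := blowDownExponent_eq hneg (K.shift ((G.blowUp v).attach none).dual₀) F
    have h3 : (0 : ℚ) ≤ blowDownExponent (K.shift ((G.blowUp v).attach none).dual₀) F := by
      exact_mod_cast blowDownExponent_nonneg _ F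
    rw [down_shift_dual₀] at h2
    rw [hm] at h1 ⊢
    rw [alexander_attach hneg, alexander_attach (hneg.blowUp v), Int.toNat_natCast]
    push_cast at h1
    linarith

theorem blowDownMap_of_mem_containing {x : (G.blowUp v).CF}
    (hx : x ∈ (G.blowUp v).containing none) : G.blowDownMap v x = 0 :=
  (Submodule.mem_bot (ZMod 2)[X]).1 (map_mem_of_mem_containing
    (fun _ _ hv => (Submodule.mem_bot _).2 (blowDownMap_gen_of_mem hv)) hx)

theorem blowDownMap_C₀ (hneg : G.NegDef) (x : (G.blowUp v).CF) :
    G.blowDownMap v ((G.blowUp v).C₀ none x) = G.blowDownMap v x := by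
  have h1 : ∀ y, G.blowDownMap v ((G.blowUp v).H₀ none y) = 0 := fun y =>
    blowDownMap_of_mem_containing (H₀_mem_containing y)
  rw [C₀_apply, map_add, map_add, blowDownMap_boundary hneg, h1, h1, map_zero, add_zero, add_zero]

/-- P kills the image of H₀ and commutes with ∂, so P C₀ = P. -/
theorem blowDownMap_contraction (hneg : G.NegDef) (x : (G.blowUp v).CF) :
    G.blowDownMap v ((G.blowUp v).contraction none x) = G.blowDownMap v x := by
  obtain ⟨n, hn⟩ := ((blowUp_isContractible G v).eventually_contraction x).exists
  rw [← hn]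
  clear hn
  induction n with
  | zero => rfl
  | succ n ih => rw [pow_succ', Module.End.mul_apply, blowDownMap_C₀ hneg, ih]

/-! ### The blow-up map -/

theorem blowUpMap_gen (K : G.Char) (E : Finset V) :
    G.blowUpMap v (gen 0 K E) =
      (G.blowUp v).contraction none (gen 0 (K.up v) (E.map Embedding.some)) :=
  lift_gen_zero _ _ _

theorem blowUpMap_hgen (hneg : G.NegDef) {q : ℚ} {K : G.Char} {E : Finset V} (h : Adm q K E) :
    G.blowUpMap v (hgen q K E) =
      (G.blowUp v).contraction none (hgen (q + 1 / 8) (K.up v) (E.map Embedding.some)) := by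
  obtain ⟨n, hn⟩ := h
  have h1 : q + 1 / 8 + weight (K.up v) (E.map Embedding.some) = n := by
    rw [weight_up hneg]; linarith
  rw [hgen_eq_gen hn, hgen_eq_gen h1, gen_eq_smul, map_smul, blowUpMap_gen, gen_eq_smul n,
    map_smul]

theorem blowDownMap_comp_blowUpMap (hneg : G.NegDef) :
    G.blowDownMap v ∘ₗ G.blowUpMap v = LinearMap.id := by
  refine hom_ext_hgen fun q K E hq => ?_
  rw [LinearMap.comp_apply, blowUpMap_hgen hneg hq, blowDownMap_contraction hneg,
    blowDownMap_hgen hneg (hq.up hneg), down_up, add_sub_cancel_right]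
  rfl

theorem blowUpMap_comp_blowDownMap (hneg : G.NegDef) :
    G.blowUpMap v ∘ₗ G.blowDownMap v = (G.blowUp v).contraction none := by
  refine hom_ext_hgen fun q K E hq => ?_
  rw [LinearMap.comp_apply]
  by_cases h : none ∈ E
  · rw [blowDownMap_hgen_of_mem h, map_zero, hgen,
      (blowUp_isContractible G v).contraction_of_mem_containing (gen_mem_containing _ _ h)]
  · obtain ⟨F, rfl⟩ : ∃ F : Finset V, E = F.map Embedding.some := ⟨_, eq_map_eraseNone h⟩
    have h1 := (hq.down hneg).up (v := v) hneg
    rw [blowDownMap_hgen hneg hq, blowUpMap_hgen hneg (hq.down hneg), sub_add_cancel]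
    rw [sub_add_cancel] at h1
    rw [up_down] at h1 ⊢
    exact ((blowUp_isContractible G v).contraction_hgen (hneg.blowUp v) h _ hq h1).symm

theorem blowUpMap_comm (hneg : G.NegDef) :
    G.blowUpMap v ∘ₗ G.boundary = (G.blowUp v).boundary ∘ₗ G.blowUpMap v := by
  refine hom_ext_hgen fun q K E hq => ?_
  simp only [LinearMap.comp_apply]
  have hup := hq.up (v := v) hneg
  rw [blowUpMap_hgen hneg hq, boundary_hgen hneg hq,
    ← (blowUp_isContractible G v).contraction_boundary (hneg.blowUp v),
    boundary_hgen (hneg.blowUp v) hup, map_sum, map_sum, Finset.sum_map]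
  refine Finset.sum_congr rfl fun w hw => ?_
  have h1 := hq.front w
  have h2 := hq.back hneg hw
  have h3 := hup.back (hneg.blowUp v) (Finset.mem_map_of_mem Embedding.some hw)
  have h4 := h2.up (v := v) hneg
  rw [Embedding.some_apply, erase_map_some] at *
  rw [map_add, map_add, blowUpMap_hgen hneg h1, blowUpMap_hgen hneg h2]
  congr 1
  by_cases hwv : w = v
  -- The lift of the back face and the back face of the lift differ by one step of an e-column,
  -- which C_e does not see.
  · subst hwv
    have h5 := (blowUp_isContractible G w).contraction_hgen (hneg.blowUp w)
      (none_notMem_map (E.erase w)) 1 h3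
    rw [one_smul, ← up_shift_dual_self] at h5
    exact (h5 h4).symm
  · rw [up_shift_dual_of_ne K hwv]

theorem blowUpMap_hasDegree :
    HasDegree 0 G.deltaPart (G.blowUp v).deltaPart (G.blowUpMap v) := by
  refine hasDegree_of_gen fun K E => ?_
  rw [blowUpMap_gen]
  refine (blowUp_isContractible G v).contraction_hasDegree _ _ ?_
  have := gen_mem_deltaPart 0 (K.up v) (E.map Embedding.some)
  rwa [Finset.card_map] at this

/-- For v ∈ E let F = E − v, x = w[K,F], y = w[K+2v^*,F]. The values at e are −1, 1 on the lift, −3,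
−1 after an e-step, and 1, 3 after the v₀'-shift. The condition a_e ≠ 0 forces x ≤ y, and then the
x-end realizes w[K+2v₀^*,E], which bounds both ends. -/
theorem weight_up_shift_dual₀ (hneg : G.NegDef) (K : G.Char) (E : Finset V)
    (ha : a none (K.up v) (insert none (E.map Embedding.some)) ≠ 0) :
    weight (K.shift (G.attach v).dual₀) E - 1 / 8 ≤
      weight ((K.up v).shift ((G.blowUp v).attach none).dual₀) (E.map Embedding.some) := by
  have hj : ((K.up v).shift ((G.blowUp v).attach none).dual₀).1 none = 1 := by
    rw [Char.shift_apply, up_none, dual₀_attach, if_pos rfl]; norm_num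
  by_cases hv : v ∈ E
  · obtain ⟨F, hF, rfl⟩ : ∃ F : Finset V, v ∉ F ∧ E = insert v F :=
      ⟨E.erase v, Finset.notMem_erase v E, (Finset.insert_erase hv).symm⟩
    have h1 := weight_insert_front (K.up v) (none_notMem_map (insert v F))
    have h2 := weight_insert_back (hneg.blowUp v) (K.up v) (none_notMem_map (insert v F))
    have h3 : (1 : ℚ) ≤ a none (K.up v) (insert none ((insert v F).map Embedding.some)) := by
      have := a_nonneg none (K.up v) (insert none ((insert v F).map Embedding.some))
      exact_mod_cast (by omega : 1 ≤ a none (K.up v) _)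
    have h4 : ((K.up v).shift ((G.blowUp v).dual none)).1 none = -3 := by
      rw [Char.shift_apply, up_none, dual_self]; rfl
    rw [b_eq_zero_of_a_ne_zero _ ha, Int.cast_zero, add_zero,
      weight_map_some_insert hneg _ hF, down_shift_dual_none, h4, down_up] at h2
    rw [weight_map_some_insert hneg _ hF, up_none, down_up] at h1
    have h5 := weight_insert_front K hF
    have h6 := weight_insert_back hneg K hF
    have h7 : weight K F ≤ weight (K.shift (G.dual v)) F := by
      -- If x ≥ y + 1, both minima equal y − 1/8 and a_e would be 0. Since x − y = a_v − b_v is an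
      -- integer, x < y + 1 improves to x ≤ y.
      have h8 : weight K F < weight (K.shift (G.dual v)) F + 1 := by
        by_contra hcon
        rw [not_lt] at hcon
        rw [min_eq_right (by push_cast; linarith)] at h1
        rw [min_eq_right (by push_cast; linarith)] at h2
        push_cast at h1 h2
        linarith
      have h9 : a v K (insert v F) < b v K (insert v F) + 1 := by
        have : (a v K (insert v F) : ℚ) < b v K (insert v F) + 1 := by linarith
        exact_mod_cast this
      have h10 : (a v K (insert v F) : ℚ) ≤ b v K (insert v F) := by
        exact_mod_cast Int.lt_add_one_iff.1 h9
      linarith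
    rw [weight_map_some_insert hneg _ hF, hj, down_shift_dual₀, down_up,
      weight_insert_shift_dual₀ hneg K hF, min_eq_left (by linarith), Char.shift_comm,
      weight_shift_dual₀_shift_dual hneg K hF, weight_shift_dual₀ K hF]
    refine le_min ?_ ?_ <;> push_cast <;> linarith
  · rw [weight_map_some hneg _ hv, hj, down_shift_dual₀, down_up]
    norm_num

/-- If a_e ≠ 0, the lift itself has small enough grading. If a_e = 0, its contraction is U^(b_e)
times that of the next cube in the e-column. The lift of K + 2v₀^* is that next cube shifted by
v₀'^*, so the gradings agree exactly. -/
theorem blowUpMap_isFiltered (hneg : G.NegDef) (m₀ m₀' : ℤ) :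
    IsFiltered ((G.attach v).alexanderFiltration m₀)
      (((G.blowUp v).attach none).alexanderFiltration m₀') (G.blowUpMap v) := by
  refine (G.attach v).isFiltered_of_gen m₀ fun K E => ?_
  have hc := blowUp_isContractible G v
  have hneg' := hneg.blowUp v
  have hn := none_notMem_map E
  rw [blowUpMap_gen]
  by_cases ha : a none (K.up v) (insert none (E.map Embedding.some)) = 0
  · have h1 := hc.contraction_column hneg' (K.up v) hn
    rw [ha, Int.toNat_zero, pow_zero, one_smul] at h1
    rw [h1]
    refine UnframedGraph.X_pow_smul_mem ((G.blowUp v).attach none) m₀'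
      (hc.contraction_isFiltered hneg' m₀' _ _
        (((G.blowUp v).attach none).gen_mem_alexanderFiltration m₀' (le_refl _))) ?_
    have h2 := weight_insert_front (K.up v) hn
    have h3 := weight_insert_back hneg' (K.up v) hn
    rw [ha, Int.cast_zero, add_zero, weight_up hneg] at h2
    obtain ⟨m, hm⟩ := Int.eq_ofNat_of_zero_le
      (b_nonneg none (K.up v) _ (Finset.mem_insert_self none (E.map Embedding.some)))
    rw [hm] at h3 ⊢
    rw [alexander_attach hneg, alexander_attach hneg', ← up_shift_dual₀, weight_up hneg, h3,
      Int.toNat_natCast]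
    push_cast
    linarith
  · refine hc.contraction_isFiltered hneg' m₀' _ _
      (((G.blowUp v).attach none).gen_mem_alexanderFiltration m₀' ?_)
    have h1 := weight_up_shift_dual₀ hneg K E ha
    rw [alexander_attach hneg, alexander_attach hneg', weight_up hneg]
    push_cast
    linarith

/-! ### The homotopy equivalence -/

theorem blowUpEdge_filtration (G : PlumbingGraph V) (v : V) (m₀' : ℤ) :
    ((G.attach v).blowUpEdge v).alexanderFiltration m₀' =
      ((G.blowUp v).attach none).alexanderFiltration m₀' := by
  have h : (insert none ((({v} : Finset V).erase v).map Embedding.some) : Finset (Option V)) =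
      {none} := by simp
  let F : Finset (Option V) → ℚ → Submodule (ZMod 2) (G.blowUp v).CF := fun s =>
    (⟨G.blowUp v, s⟩ : UnframedGraph (Option V)).alexanderFiltration m₀'
  -- The background graphs coincide definitionally, so only the set of neighbours is rewritten and
  -- no transport between complexes is needed.
  exact congrArg F h

theorem blowUp_homotopyEquiv (hneg : G.NegDef) (h : G.IsContractible v) (m₀ m₀' : ℤ) :
    IsFilteredHomotopyEquiv
      G.boundary G.deltaPart ((G.attach v).alexanderFiltration m₀)
      (G.blowUp v).boundary (G.blowUp v).deltaPart
      (((G.blowUp v).attach none).alexanderFiltration m₀')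
      (G.blowUpMap v) (G.contraction v ∘ₗ G.blowDownMap v) := by
  obtain ⟨η, hd, hf, hη⟩ := h.contraction_homotopic hneg m₀
  obtain ⟨η', hd', hf', hη'⟩ :=
    (blowUp_isContractible G v).contraction_homotopic (hneg.blowUp v) m₀'
  have hR : ∀ x, G.blowUpMap v (G.boundary x) = (G.blowUp v).boundary (G.blowUpMap v x) :=
    LinearMap.congr_fun (blowUpMap_comm hneg)
  have hP := blowDownMap_boundary (v := v) hneg
  have hPR : ∀ x, G.blowDownMap v (G.blowUpMap v x) = x :=
    LinearMap.congr_fun (blowDownMap_comp_blowUpMap hneg)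
  have hRP : ∀ x, G.blowUpMap v (G.blowDownMap v x) = (G.blowUp v).contraction none x :=
    LinearMap.congr_fun (blowUpMap_comp_blowDownMap hneg)
  have hRf := blowUpMap_isFiltered (v := v) hneg m₀ m₀'
  have hPf := blowDownMap_isFiltered (v := v) hneg m₀ m₀'
  refine ⟨⟨blowUpMap_comm hneg, blowUpMap_hasDegree, hRf⟩,
    ⟨LinearMap.ext fun x => ?_, fun k x hx => ?_,
      fun i x hx => h.contraction_isFiltered hneg m₀ i _ (hPf i x hx)⟩,
    ⟨η, hd, hf, LinearMap.ext fun x => ?_⟩,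
    -- RηP connects R C_v P with RP = C_e, and `η'` connects C_e with the identity.
    ⟨G.blowUpMap v ∘ₗ η ∘ₗ G.blowDownMap v + η', fun k x hx => ?_,
      fun i x hx => Submodule.add_mem _ (hRf _ _ (hf _ _ (hPf i x hx))) (hf' i x hx),
      LinearMap.ext fun x => ?_⟩⟩
  · simp only [LinearMap.comp_apply]
    rw [hP, h.contraction_boundary hneg]
  · exact h.contraction_hasDegree _ _ (by simpa using blowDownMap_hasDegree k x hx)
  · simp only [LinearMap.sub_apply, LinearMap.add_apply, LinearMap.comp_apply, LinearMap.id_apply]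
    rw [hPR, hη]
    abel
  · refine Submodule.add_mem _ ?_ (hd' k x hx)
    have h1 := blowUpMap_hasDegree (v := v) _ _ (hd _ _ (blowDownMap_hasDegree k x hx))
    simpa using h1
  · simp only [LinearMap.sub_apply, LinearMap.add_apply, LinearMap.comp_apply, LinearMap.id_apply]
    rw [hη, map_add, map_add, hRP, hR, hη' x, hP, map_add]
    abel

end BlowUp

end PlumbingGraph

end LatticeHomology

end

theorem mainTheorem8 {V : Type*} [Fintype V] [DecidableEq V]
    (G : LatticeHomology.PlumbingGraph V) (hforest : G.graph.IsAcyclic) (hneg : G.NegDef)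
    (v : V) (hgood : G.IsGood v) (m₀ m₀' : ℤ) :
    (∀ x : G.CF, ∃ N : ℕ, ∀ n ≥ N, (G.C₀ v ^ n) x = G.contraction v x) ∧
    (∀ x : (G.blowUp v).CF, ∃ N : ℕ, ∀ n ≥ N,
      ((G.blowUp v).C₀ none ^ n) x = (G.blowUp v).contraction none x) ∧
    LatticeHomology.IsFilteredComplex G.boundary G.deltaPart
      ((G.attach v).alexanderFiltration m₀) ∧
    LatticeHomology.IsFilteredComplex (G.blowUp v).boundary (G.blowUp v).deltaPart
      (((G.attach v).blowUpEdge v).alexanderFiltration m₀') ∧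
    LatticeHomology.IsFilteredHomotopyEquiv
      G.boundary G.deltaPart ((G.attach v).alexanderFiltration m₀)
      (G.blowUp v).boundary (G.blowUp v).deltaPart
      (((G.attach v).blowUpEdge v).alexanderFiltration m₀')
      (G.blowUpMap v) (G.contraction v ∘ₗ G.blowDownMap v) := by
  have h := hgood.isContractible hneg
  have h' := LatticeHomology.PlumbingGraph.blowUp_isContractible G v
  have hneg' := hneg.blowUp v
  rw [LatticeHomology.PlumbingGraph.blowUpEdge_filtration]
  exact ⟨fun x => Filter.eventually_atTop.1 (h.eventually_contraction x),
    fun x => Filter.eventually_atTop.1 (h'.eventually_contraction x),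
    (G.attach v).isFilteredComplex m₀ hneg,
    ((G.blowUp v).attach none).isFilteredComplex m₀' hneg',
    LatticeHomology.PlumbingGraph.blowUp_homotopyEquiv hneg h m₀ m₀'⟩
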